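/- **Theorem 3.1.** For a countable index set $\iota$ let $\ell^2(\iota)$ be the complex Hilbert space of square summable families (so $\ell^2(\mathbb N)=\ell^2$ and $\ell^2(\{1,\dots,m\})=\mathbb C^m$). Let $H^2(E)$ be the Hardy space of $E$-valued functions in $L^2$ of the unit circle $\mathbb T$ whose Fourier coefficients of negative index vanish, and let $\mathbb P_+$ be the orthogonal projection of $L^2(E)$ onto $H^2(E)$. Operators between the spaces $\ell^2(\iota)$ are identified with matrices; $A^{t}$ is the transpose and $\overline A$ the entrywise complex conjugate. For a weakly measurable, essentially bounded operator function $\Phi$ on $\mathbb T$, $T_\Phi f=\mathbb P_+(\Phi f)$ ($f\in H^2$) is its Toeplitz operator. A bounded analytic function $\Phi\in H^\infty(\mathcal B(E,F))$ is *inner* if $\Phi(\zeta)^*\Phi(\zeta)=I$ for almost all $\zeta\in\mathbb T$, *outer* if the set of functions $\Phi q$, $q$ an analytic polynomial with coefficients in $E$, is dense in $H^2(F)$, and *co-outer* if $\Phi^{t}$ is bounded analytic and outer. The matrix function $(\Upsilon\ \ \overline\Theta)$ is *balanced* if it is unitary-valued (for almost all $\zeta\in\mathbb T$) and $\Upsilon$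 and $\Theta$ are both inner and co-outer. Let $r$ be a positive integer and let $\Upsilon\in H^\infty(\mathcal B(\mathbb C^r,\ell^2))$ be inner. Then there are a space $\mathcal K=\ell^2(\kappa)$, with $\kappa$ countable, and an inner function $\Theta\in H^\infty(\mathcal B(\mathcal K,\ell^2))$ such that $$\operatorname{Ker}T_{\Upsilon^{t}}=\Theta H^2(\mathcal K),$$ and for every such $\mathcal K$ and every such inner function $\Theta$: 1. $\Theta$ is co-outer; 2. the matrix function $(\Upsilon\ \ \overline\Theta)$ is unitary-valued, i.e. for almost all $\zeta\in\mathbb T$ the operator $(x,y)\mapsto\Upsilon(\zeta)x+\overline{\Theta(\zeta)}\,y$ from $\mathbb C^r\oplus\mathcal K$ to $\ell^2$ is unitary. In particular, if $\Upsilon$ is moreover co-outer, then $(\Upsilon\ \ \overline\Theta)$ is balanced, so that $\Upsilon$ has a balanced completion. -/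

import Mathlib

open MeasureTheory

noncomputable section

namespace OpFun

/-- The unit circle, parametrized as `ζ = exp (2πit)` with `t ∈ ℝ/ℤ`; the monomial `ζ ^ n` is
Mathlib's `fourier n`. -/
abbrev Circ : Type := UnitAddCircle

/-- Normalized Lebesgue (Haar) measure on the unit circle. -/
abbrev haar : Measure Circ := AddCircle.haarAddCircle

/-- The complex Hilbert space `ℓ²(ι)`.  For `ι = ℕ` it is `ℓ²`, for `ι = Fin m` it is `ℂ^m` with
its Euclidean norm. -/
abbrev Ell2 (ι : Type*) : Type _ := lp (fun _ : ι => ℂ) 2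

/-- The space `L²(E)` of square integrable `E`-valued functions on the circle. -/
abbrev L2 (E : Type*) [NormedAddCommGroup E] : Type _ := Lp E 2 haar

section Hardy

variable (E : Type*) [NormedAddCommGroup E] [InnerProductSpace ℂ E]

theorem integrable_L2 {E : Type*} [NormedAddCommGroup E] (f : L2 E) : Integrable f haar :=
  (Lp.memLp f).integrable (by norm_num)

/-- The Hardy space `H²(E)`, as the subspace of those `f ∈ L²(E)` (boundary values) whose Fourier
coefficients of negative index vanish. -/
def H2 : Submodule ℂ (L2 E) where
  carrier := {f | ∀ n : ℤ, n < 0 → fourierCoeff (f : Circ → E) n = 0}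
  add_mem' := by
    intro f g hf hg n hn
    have h : fourierCoeff ((f + g : L2 E) : Circ → E) n
        = fourierCoeff ((f : Circ → E) + (g : Circ → E)) n := by
      unfold fourierCoeff
      apply integral_congr_ae
      filter_upwards [Lp.coeFn_add f g] with t ht
      rw [ht]
    rw [h, fourierCoeff.add (integrable_L2 f) (integrable_L2 g)]
    simp [hf n hn, hg n hn]
  zero_mem' := by
    intro n _
    have h : fourierCoeff ((0 : L2 E) : Circ → E) n = fourierCoeff (0 : Circ → E) n := by
      unfold fourierCoeff
      apply integral_congr_ae
      filter_upwards [Lp.coeFn_zero E 2 haar] with t ht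
      rw [ht]
    rw [h]
    simp [fourierCoeff]
  smul_mem' := by
    intro c f hf n hn
    have h : fourierCoeff ((c • f : L2 E) : Circ → E) n
        = fourierCoeff (fun t => c • (f : Circ → E) t) n := by
      unfold fourierCoeff
      apply integral_congr_ae
      filter_upwards [Lp.coeFn_smul c f] with t ht
      rw [ht]; rfl
    rw [h]
    exact (fourierCoeff.const_smul (f : Circ → E) c n).trans (by rw [hf n hn, smul_zero])

theorem isClosed_H2 : IsClosed (H2 E : Set (L2 E)) := by
  have key : ∀ n : ℤ, Continuous fun f : L2 E => fourierCoeff (f : Circ → E) n := by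
    intro n
    have hdiff : ∀ f g : L2 E, dist (fourierCoeff (f : Circ → E) n)
        (fourierCoeff (g : Circ → E) n) ≤ dist f g := by
      intro f g
      have hf := (integrable_L2 f).fourier_smul (-n)
      have hg := (integrable_L2 g).fourier_smul (-n)
      rw [dist_eq_norm, dist_eq_norm]
      unfold fourierCoeff
      rw [← integral_sub hf hg]
      calc _ ≤ ∫ t, ‖((f - g : L2 E) : Circ → E) t‖ ∂haar := by
            refine (norm_integral_le_integral_norm _).trans (le_of_eq ?_)
            apply integral_congr_ae
            filter_upwards [Lp.coeFn_sub f g] with t ht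
            rw [ht, ← smul_sub, norm_smul, Pi.sub_apply, fourier_apply, Circle.norm_coe, one_mul]
        _ = (eLpNorm ((f - g : L2 E) : Circ → E) 1 haar).toReal := by
            rw [eLpNorm_one_eq_lintegral_enorm, integral_norm_eq_lintegral_enorm
              (Lp.aestronglyMeasurable _)]
        _ ≤ ‖f - g‖ := by
            rw [Lp.norm_def]
            exact ENNReal.toReal_mono (Lp.eLpNorm_ne_top _)
              (eLpNorm_le_eLpNorm_of_exponent_le (by norm_num) (Lp.aestronglyMeasurable _))
    exact (LipschitzWith.of_dist_le_mul (K := 1) (by simpa using hdiff)).continuous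
  have : (H2 E : Set (L2 E))
      = ⋂ n : ℤ, ⋂ _ : n < 0, {f : L2 E | fourierCoeff (f : Circ → E) n = 0} := by
    ext f
    simp [H2]
  rw [this]
  exact isClosed_iInter fun n => isClosed_iInter fun _ => isClosed_eq (key n) continuous_const

instance [CompleteSpace E] : CompleteSpace (H2 E) := (isClosed_H2 E).completeSpace_coe

/-- The analytic polynomials `x₀ + ζ x₁ + ⋯ + ζ ^ (n - 1) x_(n-1)` with coefficients in `E`, as
elements of `L²(E)`. -/
def polynomials : Set (L2 E) :=
  {q | ∃ (n : ℕ) (x : ℕ → E),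
    (q : Circ → E) =ᵐ[haar] fun t => ∑ k ∈ Finset.range n, fourier (k : ℤ) t • x k}

end Hardy

section Matrices

variable {ι κ : Type*}

/-- Coordinatewise complex conjugation on `ℓ²(ι)`. -/
def conjMap (ι : Type*) : Ell2 ι →L⋆[ℂ] Ell2 ι :=
  (starₗᵢ ℂ : Ell2 ι ≃ₗᵢ⋆[ℂ] Ell2 ι).toContinuousLinearEquiv.toContinuousLinearMap

/-- The entrywise complex conjugate of the (possibly infinite) matrix of `A`. -/
def conjOp (A : Ell2 ι →L[ℂ] Ell2 κ) : Ell2 ι →L[ℂ] Ell2 κ :=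
  (conjMap κ).comp (A.comp (conjMap ι))

/-- The transpose of the (possibly infinite) matrix of `A`: the entrywise conjugate of its
adjoint. -/
def transposeOp (A : Ell2 ι →L[ℂ] Ell2 κ) : Ell2 κ →L[ℂ] Ell2 ι :=
  conjOp (ContinuousLinearMap.adjoint A)

/-- The block matrix `(A B)`, acting from the Hilbert space direct sum. -/
def rowOp {E F G : Type*} [NormedAddCommGroup E] [InnerProductSpace ℂ E]
    [NormedAddCommGroup F] [InnerProductSpace ℂ F] [NormedAddCommGroup G] [InnerProductSpace ℂ G]
    (A : E →L[ℂ] G) (B : F →L[ℂ] G) : WithLp 2 (E × F) →L[ℂ] G :=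
  A.comp (WithLp.fstL 2 ℂ E F) + B.comp (WithLp.sndL 2 ℂ E F)

/-- `U` is a unitary operator from `E` onto `G`: `U* U = I` and `U U* = I`. -/
def IsUnitaryOp {E G : Type*} [NormedAddCommGroup E] [InnerProductSpace ℂ E] [CompleteSpace E]
    [NormedAddCommGroup G] [InnerProductSpace ℂ G] [CompleteSpace G] (U : E →L[ℂ] G) : Prop :=
  (ContinuousLinearMap.adjoint U).comp U = ContinuousLinearMap.id ℂ E ∧
    U.comp (ContinuousLinearMap.adjoint U) = ContinuousLinearMap.id ℂ G

theorem inner_conjMap (x y : Ell2 ι) :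
    inner ℂ (conjMap ι x) (conjMap ι y) = inner ℂ y x := by
  simp [conjMap, lp.inner_eq_tsum, lp.star_apply, mul_comm]

theorem inner_conjMap_left (x y : Ell2 ι) :
    inner ℂ (conjMap ι x) y = inner ℂ (conjMap ι y) x := by
  have h : conjMap ι (conjMap ι y) = y := by simp [conjMap]
  conv_lhs => rw [← h]
  exact inner_conjMap _ _

theorem norm_conjMap (x : Ell2 ι) : ‖conjMap ι x‖ = ‖x‖ :=
  (starₗᵢ ℂ : Ell2 ι ≃ₗᵢ⋆[ℂ] Ell2 ι).norm_map x

theorem norm_conjOp_le (A : Ell2 ι →L[ℂ] Ell2 κ) : ‖conjOp A‖ ≤ ‖A‖ := by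
  refine ContinuousLinearMap.opNorm_le_bound _ (norm_nonneg _) fun x => ?_
  change ‖conjMap κ (A (conjMap ι x))‖ ≤ _
  rw [norm_conjMap]
  simpa [norm_conjMap] using A.le_opNorm (conjMap ι x)

theorem norm_transposeOp_le (A : Ell2 ι →L[ℂ] Ell2 κ) : ‖transposeOp A‖ ≤ ‖A‖ :=
  (norm_conjOp_le _).trans (le_of_eq (LinearIsometryEquiv.norm_map _ _))

end Matrices

/-- A function in `L^∞(B(ℓ²(ι), ℓ²(κ)))`, i.e. a weakly measurable, essentially bounded function on
the circle with values in the bounded operators, viewed as a `κ × ι` matrix function (it has columns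
indexed by `ι` and rows indexed by `κ`). -/
structure MatFun (ι κ : Type*) where
  /-- The values of the function. -/
  toFun : Circ → (Ell2 ι →L[ℂ] Ell2 κ)
  weaklyMeasurable : ∀ (x : Ell2 ι) (y : Ell2 κ),
    AEStronglyMeasurable (fun t => (inner ℂ y (toFun t x) : ℂ)) haar
  bounded : ∃ C : ℝ, ∀ᵐ t ∂haar, ‖toFun t‖ ≤ C

namespace MatFun

variable {ι κ : Type*}

/-- The (pointwise) transposed matrix function `Φ^t`. -/
def transpose (Φ : MatFun ι κ) : MatFun κ ι where
  toFun t := transposeOp (Φ.toFun t)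
  weaklyMeasurable := by
    intro x y
    refine (Φ.weaklyMeasurable (conjMap ι y) (conjMap κ x)).congr (Filter.Eventually.of_forall ?_)
    intro t
    change inner ℂ (conjMap κ x) (Φ.toFun t (conjMap ι y))
      = inner ℂ y (conjMap ι (ContinuousLinearMap.adjoint (Φ.toFun t) (conjMap κ x)))
    rw [← ContinuousLinearMap.adjoint_inner_left, ← inner_conjMap]
    simp [conjMap]
  bounded := by
    obtain ⟨C, hC⟩ := Φ.bounded
    exact ⟨C, hC.mono fun t ht => (norm_transposeOp_le _).trans ht⟩

theorem aestronglyMeasurable_of_coord [Countable κ] {g : Circ → Ell2 κ}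
    (hg : ∀ i, AEStronglyMeasurable (fun t => g t i) haar) : AEStronglyMeasurable g haar := by
  classical
  refine aestronglyMeasurable_of_tendsto_ae (u := (Filter.atTop : Filter (Finset κ)))
    (f := fun s t => ∑ i ∈ s, lp.single 2 i (g t i)) ?_ ?_
  · intro s
    refine Finset.aestronglyMeasurable_fun_sum s fun i _ => ?_
    have hc : Continuous fun c : ℂ => (lp.single 2 i c : Ell2 κ) := by
      have : (fun c : ℂ => (lp.single 2 i c : Ell2 κ)) = fun c => c • lp.single 2 i (1 : ℂ) := by
        funext c
        rw [← lp.single_smul]; simp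
      rw [this]
      fun_prop
    exact hc.comp_aestronglyMeasurable (hg i)
  · exact Filter.Eventually.of_forall fun t => lp.hasSum_single (by norm_num) (g t)

theorem aestronglyMeasurable_mul [Countable κ] (Φ : MatFun ι κ) {f : Circ → Ell2 ι}
    (hf : AEStronglyMeasurable f haar) :
    AEStronglyMeasurable (fun t => Φ.toFun t (f t)) haar := by
  classical
  have hx : ∀ x, AEStronglyMeasurable (fun t => Φ.toFun t x) haar := by
    intro x
    refine aestronglyMeasurable_of_coord fun i => ?_
    refine (Φ.weaklyMeasurable x (lp.single 2 i (1 : ℂ))).congr (Filter.Eventually.of_forall ?_)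
    intro t
    simp [lp.inner_single_left]
  obtain ⟨g, hg, hfg⟩ := hf
  refine AEStronglyMeasurable.congr (f := fun t => Φ.toFun t (g t)) ?_
    (hfg.mono fun t ht => by simp only [ht])
  refine aestronglyMeasurable_of_tendsto_ae (u := Filter.atTop)
    (f := fun n t => Φ.toFun t (hg.approx n t)) ?_
    (Filter.Eventually.of_forall fun t => ((Φ.toFun t).continuous.tendsto _).comp
      (hg.tendsto_approx t))
  intro n
  have : (fun t => Φ.toFun t (hg.approx n t)) = fun t => ∑ y ∈ (hg.approx n).range,
      Set.indicator (hg.approx n ⁻¹' {y}) (fun t => Φ.toFun t y) t := by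
    funext t
    rw [Finset.sum_eq_single (hg.approx n t)]
    · simp
    · intro y _ hy
      exact Set.indicator_of_notMem (fun h => hy (by simpa using h.symm)) _
    · intro h
      exact absurd (SimpleFunc.mem_range_self _ t) h
  rw [this]
  exact Finset.aestronglyMeasurable_fun_sum _ fun y _ =>
    (hx y).indicator ((hg.approx n).measurableSet_fiber y)

theorem memLp_mul [Countable κ] (Φ : MatFun ι κ) (f : L2 (Ell2 ι)) :
    MemLp (fun t => Φ.toFun t (f t)) 2 haar := by
  obtain ⟨C, hC⟩ := Φ.bounded
  refine MemLp.of_le_mul (c := C) (Lp.memLp f)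
    (Φ.aestronglyMeasurable_mul (Lp.aestronglyMeasurable f)) ?_
  filter_upwards [hC] with t ht
  exact (ContinuousLinearMap.le_opNorm _ _).trans
    (mul_le_mul_of_nonneg_right ht (norm_nonneg _))

/-- Multiplication by `Φ`: the operator `f ↦ Φ f` from `L²(ℓ²(ι))` to `L²(ℓ²(κ))`. -/
def mulOp [Countable κ] (Φ : MatFun ι κ) : L2 (Ell2 ι) →ₗ[ℂ] L2 (Ell2 κ) where
  toFun f := (Φ.memLp_mul f).toLp _
  map_add' f g := by
    rw [← MemLp.toLp_add, MemLp.toLp_eq_toLp_iff]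
    filter_upwards [Lp.coeFn_add f g] with t ht
    rw [ht, Pi.add_apply, Pi.add_apply, map_add]
  map_smul' c f := by
    rw [RingHom.id_apply, ← MemLp.toLp_const_smul, MemLp.toLp_eq_toLp_iff]
    filter_upwards [Lp.coeFn_smul c f] with t ht
    rw [ht, Pi.smul_apply, Pi.smul_apply, map_smul]

/-- The Toeplitz operator `T_Φ f = P₊ (Φ f)` from `H²(ℓ²(ι))` to `H²(ℓ²(κ))`, where `P₊` is the
orthogonal projection of `L²(ℓ²(κ))` onto `H²(ℓ²(κ))`. -/
def toeplitz [Countable κ] (Φ : MatFun ι κ) : H2 (Ell2 ι) →ₗ[ℂ] H2 (Ell2 κ) :=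
  (H2 (Ell2 κ)).orthogonalProjectionOnto.toLinearMap ∘ₗ Φ.mulOp ∘ₗ (H2 (Ell2 ι)).subtype

/-- `Φ` is analytic: `Φ x` belongs to `H²(ℓ²(κ))` for every constant vector `x`.  As `Φ` is bounded,
this says that `Φ` is (the boundary value function of) a function in `H^∞(B(ℓ²(ι), ℓ²(κ)))`. -/
def IsAnalytic [Countable κ] (Φ : MatFun ι κ) : Prop :=
  ∀ (x : Ell2 ι) (n : ℤ), n < 0 → fourierCoeff (fun t => Φ.toFun t x) n = 0

/-- `Φ` is inner: it is analytic and `Φ(ζ)* Φ(ζ) = I` for almost all `ζ`. -/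
def IsInner [Countable κ] (Φ : MatFun ι κ) : Prop :=
  Φ.IsAnalytic ∧ ∀ᵐ t ∂haar,
    (ContinuousLinearMap.adjoint (Φ.toFun t)).comp (Φ.toFun t) = ContinuousLinearMap.id ℂ (Ell2 ι)

/-- `Φ` is outer: it is analytic and the functions `Φ q`, with `q` an analytic polynomial, are dense
in the Hardy space `H²(ℓ²(κ))`. -/
def IsOuter [Countable κ] (Φ : MatFun ι κ) : Prop :=
  Φ.IsAnalytic ∧ closure (Φ.mulOp '' polynomials (Ell2 ι)) = (H2 (Ell2 κ) : Set (L2 (Ell2 κ)))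

/-- `Φ` is co-outer: the transposed function `Φ^t` is outer. -/
def IsCoOuter [Countable ι] (Φ : MatFun ι κ) : Prop :=
  Φ.transpose.IsOuter

/-- The kernel of the Toeplitz operator `T_Φ`, as a subspace of `L²`. -/
def toeplitzKer [Countable κ] (Φ : MatFun ι κ) : Submodule ℂ (L2 (Ell2 ι)) :=
  (LinearMap.ker Φ.toeplitz).map (H2 (Ell2 ι)).subtype

/-- The subspace `Φ H²(ℓ²(ι))` of `L²(ℓ²(κ))`. -/
def rangeH2 [Countable κ] (Φ : MatFun ι κ) : Submodule ℂ (L2 (Ell2 κ)) :=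
  (H2 (Ell2 ι)).map Φ.mulOp

/-- The matrix function `(Υ  conj Θ)` is unitary-valued, where `conj Θ` is the entrywise complex
conjugate of `Θ`. -/
def IsUnitaryValued {ι' : Type*} (Υ : MatFun ι κ) (Θ : MatFun ι' κ) : Prop :=
  ∀ᵐ t ∂haar, IsUnitaryOp (rowOp (Υ.toFun t) (conjOp (Θ.toFun t)))

/-- The matrix function `(Υ  conj Θ)` is balanced: `Υ` and `Θ` are inner and co-outer, and
`(Υ  conj Θ)` is unitary-valued. -/
def IsBalanced {ι' : Type*} [Countable ι] [Countable ι'] [Countable κ]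
    (Υ : MatFun ι κ) (Θ : MatFun ι' κ) : Prop :=
  (Υ.IsInner ∧ Υ.IsCoOuter) ∧ (Θ.IsInner ∧ Θ.IsCoOuter) ∧ IsUnitaryValued Υ Θ

end MatFun

end OpFun

end

/-! Since `Υᵗ` is analytic, `P₊` does nothing on `Υᵗ H²`, and the kernel of the Toeplitz operator is
`{f ∈ H² : Υᵗ f = 0}`. This is closed and invariant under multiplication by `ζ`, so the
Beurling–Lax–Halmos theorem (`exists_isInner_rangeH2_eq`) gives `Θ`. That theorem takes an
orthonormal basis of the wandering subspace `M ⊖ ζM`; its elements are orthonormal at almost every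
point and serve as the columns of `Θ`, and the Wold argument `le_of_wandering_mem` shows that they
generate `M`.

Co-outerness (`isCoOuter_of_rangeH2_eq`) is maximality of the kernel. If `g ∈ H²` is orthogonal to
all `Θᵗ q`, then `Θ ζ⁻¹ ḡ` lies in `H²` and is killed by `Υᵗ`, hence lies in `Θ H²`. So `ζ⁻¹ ḡ ∈
H²`, while `g ∈ H²` leaves it only negative frequencies; thus `g = 0`.

For unitarity, `Υᵗ Θ = 0` makes the ranges of `Υ(ζ)` and of the conjugate of `Θ(ζ)` orthogonal. They
fill `ℓ²` once `Ker Υ(ζ)ᵗ ⊆ Ran Θ(ζ)` (`ae_ker_le_range`). Here the finiteness of `r` enters: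
Cramer's rule on `r` columns of `Υᵗ` yields bounded analytic elements of the kernel, and wherever
that minor is nonzero their values span a dense subspace of the pointwise kernel. As `Υᵗ` is
surjective almost everywhere, some minor is nonzero. -/

open MeasureTheory

noncomputable section

namespace OpFun

/-! ### Uniqueness of Fourier coefficients for vector-valued functions -/

section FourierCoefficients

variable {E : Type*} [NormedAddCommGroup E]

/-- The integral is Lipschitz in `g` for the sup norm, and the monomials span a dense subspace of
the continuous functions. -/
theorem integral_continuousMap_smul_eq_zero [NormedSpace ℂ E] {f : Circ → E}
    (hf : Integrable f haar) (h : ∀ n, fourierCoeff f n = 0) (g : C(Circ, ℂ)) :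
    ∫ t, g t • f t ∂haar = 0 := by
  have hint : ∀ g : C(Circ, ℂ), Integrable (fun t => g t • f t) haar := fun g =>
    hf.bdd_smul ‖g‖ g.continuous.aestronglyMeasurable (ae_of_all _ fun t => g.norm_coe_le_norm t)
  let K : Submodule ℂ C(Circ, ℂ) :=
    { carrier := {g | ∫ t, g t • f t ∂haar = 0}
      add_mem' := by
        intro a b ha hb
        simp only [Set.mem_ofPred_eq, ContinuousMap.add_apply, add_smul] at *
        rw [integral_add (hint a) (hint b), ha, hb, add_zero]
      zero_mem' := by simp
      smul_mem' := by
        intro c a ha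
        simp only [Set.mem_ofPred_eq, ContinuousMap.smul_apply, smul_assoc] at *
        rw [integral_smul, ha, smul_zero] }
  have hK : IsClosed (K : Set C(Circ, ℂ)) := by
    refine isClosed_eq ?_ continuous_const
    refine (LipschitzWith.of_dist_le_mul (K := ⟨∫ t, ‖f t‖ ∂haar, by positivity⟩)
      fun a b => ?_).continuous
    rw [dist_eq_norm, dist_eq_norm, ← integral_sub (hint a) (hint b)]
    refine (norm_integral_le_integral_norm _).trans ?_
    change _ ≤ (∫ t, ‖f t‖ ∂haar) * ‖a - b‖
    rw [← integral_mul_const]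
    refine integral_mono_of_nonneg (ae_of_all _ fun t => norm_nonneg _)
      (hf.norm.mul_const _) (ae_of_all _ fun t => ?_)
    change ‖a t • f t - b t • f t‖ ≤ ‖f t‖ * ‖a - b‖
    rw [← sub_smul, norm_smul, mul_comm]
    exact mul_le_mul_of_nonneg_left ((a - b).norm_coe_le_norm t) (norm_nonneg _)
  have htop : (⊤ : Submodule ℂ C(Circ, ℂ)) ≤ K := by
    rw [← span_fourier_closure_eq_top]
    refine Submodule.topologicalClosure_minimal _ (Submodule.span_le.2 ?_) hK
    rintro _ ⟨n, rfl⟩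
    have := h (-n)
    rwa [fourierCoeff, neg_neg] at this
  exact htop (Submodule.mem_top : g ∈ _)

/-- An integrable function all of whose Fourier coefficients vanish is zero almost everywhere. -/
theorem ae_eq_zero_of_fourierCoeff_eq_zero [NormedSpace ℂ E] [CompleteSpace E] {f : Circ → E}
    (hf : Integrable f haar) (h : ∀ n, fourierCoeff f n = 0) : f =ᵐ[haar] 0 := by
  refine ae_eq_zero_of_forall_setIntegral_isClosed_eq_zero hf fun F hF => ?_
  -- Continuous functions converging boundedly to the indicator of `F`, so that dominated
  -- convergence applies.
  let u : ℕ → C(Circ, ℂ) := fun n =>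
    ⟨fun t => ((hF.apprSeq n t : NNReal) : ℂ), by fun_prop⟩
  have hu : ∀ n t, ‖u n t‖ ≤ 1 := by
    intro n t
    have := HasOuterApproxClosed.apprSeq_apply_le_one hF n t
    simpa [u] using this
  have hlim : Filter.Tendsto (fun n => ∫ t, u n t • f t ∂haar) Filter.atTop
      (nhds (∫ t, F.indicator f t ∂haar)) := by
    refine tendsto_integral_of_dominated_convergence (fun t => ‖f t‖)
      (fun n => ((u n).continuous.aestronglyMeasurable).smul hf.aestronglyMeasurable) hf.norm
      (fun n => ae_of_all _ fun t => ?_) (ae_of_all _ fun t => ?_)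
    · rw [norm_smul]
      exact mul_le_of_le_one_left (norm_nonneg _) (hu n t)
    · have h1 := (tendsto_pi_nhds.1 (HasOuterApproxClosed.tendsto_apprSeq hF)) t
      have h2 : Filter.Tendsto (fun n => u n t) Filter.atTop
          (nhds (((F.indicator (fun _ => (1 : NNReal)) t : NNReal) : ℂ))) :=
        ((Complex.continuous_ofReal.comp NNReal.continuous_coe).tendsto _).comp h1
      have h3 := h2.smul_const (f t)
      convert h3 using 2
      by_cases ht : t ∈ F <;> simp [ht]
  rw [← integral_indicator hF.measurableSet]
  refine tendsto_nhds_unique hlim ?_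
  simp [integral_continuousMap_smul_eq_zero hf h]

theorem ae_eq_const_of_fourierCoeff {f : Circ → ℂ} (hf : Integrable f haar) (c : ℂ)
    (h : ∀ n, fourierCoeff f n = if n = 0 then c else 0) : ∀ᵐ t ∂haar, f t = c := by
  have h0 : (fun t => f t - c) =ᵐ[haar] 0 := by
    refine ae_eq_zero_of_fourierCoeff_eq_zero (hf.sub (integrable_const c)) fun n => ?_
    have hc : fourierCoeff (fun _ : Circ => c) n = if n = 0 then c else 0 := by
      have h1 : (fun _ : Circ => c) = c • (fun t : Circ => (fourier 0 t : ℂ)) := by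
        funext t; simp
      rw [h1, fourierCoeff.const_smul, fourierCoeff_fourier]
      simp [Pi.single_apply]
    have h2 : fourierCoeff (fun t => f t - c) n
        = fourierCoeff f n - fourierCoeff (fun _ : Circ => c) n := by
      simp only [fourierCoeff, smul_sub]
      exact integral_sub (hf.fourier_smul _) ((integrable_const c).fourier_smul _)
    rw [h2, h, hc, sub_self]
  filter_upwards [h0] with t ht
  exact sub_eq_zero.1 ht

theorem fourierCoeff_fourier_smul [NormedSpace ℂ E] (f : Circ → E) (m n : ℤ) :
    fourierCoeff (fun t => fourier m t • f t) n = fourierCoeff f (n - m) := by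
  unfold fourierCoeff
  congr 1
  funext t
  rw [smul_smul, ← fourier_add]
  congr 3
  ring

theorem _root_.ContinuousLinearMap.fourierCoeff_comp {F : Type*} [NormedSpace ℂ E]
    [CompleteSpace E] [NormedAddCommGroup F] [NormedSpace ℂ F] [CompleteSpace F] (L : E →L[ℂ] F)
    {f : Circ → E} (hf : Integrable f haar) (n : ℤ) :
    fourierCoeff (fun t => L (f t)) n = L (fourierCoeff f n) := by
  unfold fourierCoeff
  rw [← ContinuousLinearMap.integral_comp_comm L (hf.fourier_smul _)]
  simp only [map_smul]

/-- The constant function `x`, as an element of `L²(E)`. -/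
def const (x : E) : L2 E := (memLp_const x).toLp _

theorem coeFn_const (x : E) : (const x : Circ → E) =ᵐ[haar] fun _ => x :=
  MemLp.coeFn_toLp _

theorem coeFn_finset_sum {α : Type*} (s : Finset α) (f : α → L2 E) :
    ((∑ i ∈ s, f i : L2 E) : Circ → E) =ᵐ[haar] fun t => ∑ i ∈ s, f i t := by
  classical
  induction s using Finset.induction_on with
  | empty => exact (Lp.coeFn_zero E 2 haar).trans (ae_of_all _ fun t => by simp)
  | insert a s ha ih =>
    rw [Finset.sum_insert ha]
    filter_upwards [ih, Lp.coeFn_add (f a) (∑ i ∈ s, f i)] with t h1 h2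
    rw [h2, Pi.add_apply, h1, Finset.sum_insert ha]

end FourierCoefficients

/-! ### Shifts, monomials and the Hardy space -/

section Shift

variable {E : Type*} [NormedAddCommGroup E] [InnerProductSpace ℂ E]

theorem norm_fourier_apply (m : ℤ) (t : Circ) : ‖(fourier m t : ℂ)‖ = 1 := by
  rw [fourier_apply, Circle.norm_coe]

theorem memLp_fourier_smul (m : ℤ) {f : Circ → E} (hf : MemLp f 2 haar) :
    MemLp (fun t => fourier m t • f t) 2 haar := by
  refine hf.of_le (((map_continuous (fourier m)).aestronglyMeasurable).smul
    hf.aestronglyMeasurable) (ae_of_all _ fun t => ?_)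
  rw [norm_smul, norm_fourier_apply, one_mul]

/-- Multiplication by the monomial `ζ ^ m` on `L²(E)`. -/
def shift (m : ℤ) : L2 E →ₗᵢ[ℂ] L2 E where
  toFun f := (memLp_fourier_smul m (Lp.memLp f)).toLp _
  map_add' f g := by
    rw [← MemLp.toLp_add, MemLp.toLp_eq_toLp_iff]
    filter_upwards [Lp.coeFn_add f g] with t ht
    rw [ht, Pi.add_apply, Pi.add_apply, smul_add]
  map_smul' c f := by
    rw [RingHom.id_apply, ← MemLp.toLp_const_smul, MemLp.toLp_eq_toLp_iff]
    filter_upwards [Lp.coeFn_smul c f] with t ht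
    rw [ht, Pi.smul_apply, Pi.smul_apply, smul_comm]
  norm_map' f := by
    change ‖(memLp_fourier_smul m (Lp.memLp f)).toLp _‖ = _
    rw [Lp.norm_toLp, Lp.norm_def]
    congr 1
    refine eLpNorm_congr_norm_ae (ae_of_all _ fun t => ?_)
    rw [norm_smul, norm_fourier_apply, one_mul]

theorem coeFn_shift (m : ℤ) (f : L2 E) :
    (shift m f : Circ → E) =ᵐ[haar] fun t => fourier m t • f t :=
  (memLp_fourier_smul m (Lp.memLp f)).coeFn_toLp

theorem shift_shift (m n : ℤ) (f : L2 E) : shift m (shift n f) = shift (m + n) f := by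
  refine Lp.ext ?_
  filter_upwards [coeFn_shift m (shift n f), coeFn_shift n f, coeFn_shift (m + n) f]
    with t h1 h2 h3
  rw [h1, h2, h3, smul_smul, ← fourier_add]

theorem shift_zero (f : L2 E) : shift 0 f = f := by
  refine Lp.ext ?_
  filter_upwards [coeFn_shift 0 f] with t h1
  rw [h1, fourier_zero, one_smul]

theorem fourierCoeff_shift (m : ℤ) (f : L2 E) (n : ℤ) :
    fourierCoeff (shift m f : Circ → E) n = fourierCoeff (f : Circ → E) (n - m) := by
  rw [fourierCoeff_congr_ae (coeFn_shift m f), fourierCoeff_fourier_smul]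

theorem inner_shift_left (m : ℤ) (f g : L2 E) :
    inner ℂ (shift m f) g = inner ℂ f (shift (-m) g) := by
  rw [← LinearIsometry.inner_map_map (shift (E := E) m) f, shift_shift, add_neg_cancel, shift_zero]

/-- `x ↦ const x` as a continuous linear map. -/
def constL (E : Type*) [NormedAddCommGroup E] [InnerProductSpace ℂ E] : E →L[ℂ] L2 E :=
  Lp.constL 2 haar ℂ

/-- The monomial `ζ ^ n x`, as an element of `L²(E)`. -/
def monomial (n : ℤ) (x : E) : L2 E := shift n (const x)

theorem coeFn_monomial (n : ℤ) (x : E) :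
    (monomial n x : Circ → E) =ᵐ[haar] fun t => fourier n t • x := by
  filter_upwards [coeFn_shift n (const x), coeFn_const x] with t h1 h2
  rw [monomial, h1, h2]

theorem mem_H2 {f : L2 E} : f ∈ H2 E ↔ ∀ n : ℤ, n < 0 → fourierCoeff (f : Circ → E) n = 0 :=
  Iff.rfl

theorem shift_mem_H2 {m : ℤ} (hm : 0 ≤ m) {f : L2 E} (hf : f ∈ H2 E) : shift m f ∈ H2 E := by
  intro n hn
  rw [fourierCoeff_shift]
  exact hf _ (by omega)

theorem toLp_mem_H2 {f : Circ → E} (hf : MemLp f 2 haar) :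
    hf.toLp f ∈ H2 E ↔ ∀ n : ℤ, n < 0 → fourierCoeff f n = 0 := by
  rw [mem_H2, fourierCoeff_congr_ae hf.coeFn_toLp]

theorem monomial_zero (x : E) : monomial 0 x = const x := shift_zero _

theorem monomial_mem_polynomials (k : ℕ) (x : E) : monomial k x ∈ polynomials E := by
  refine ⟨k + 1, fun j => if j = k then x else 0, ?_⟩
  filter_upwards [coeFn_monomial (k : ℤ) x] with t ht
  rw [ht, Finset.sum_eq_single k]
  · simp
  · intro j _ hj
    simp [hj]
  · simp

theorem mem_polynomials_iff {q : L2 E} :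
    q ∈ polynomials E ↔ ∃ (n : ℕ) (x : ℕ → E), q = ∑ k ∈ Finset.range n, monomial k (x k) := by
  have key : ∀ (n : ℕ) (x : ℕ → E),
      ((∑ k ∈ Finset.range n, monomial (k : ℤ) (x k) : L2 E) : Circ → E) =ᵐ[haar]
        fun t => ∑ k ∈ Finset.range n, fourier (k : ℤ) t • x k := by
    intro n x
    filter_upwards [coeFn_finset_sum (Finset.range n) fun k => monomial (k : ℤ) (x k),
      ae_all_iff.2 fun k : ℕ => coeFn_monomial (k : ℤ) (x k)] with t h1 h2
    rw [h1]
    exact Finset.sum_congr rfl fun k _ => h2 k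
  constructor
  · rintro ⟨n, x, h⟩
    exact ⟨n, x, Lp.ext (h.trans (key n x).symm)⟩
  · rintro ⟨n, x, rfl⟩
    exact ⟨n, x, key n x⟩

/-- The analytic polynomials form the span of the analytic monomials. -/
theorem polynomials_eq_span : polynomials E
    = Submodule.span ℂ (Set.range fun p : ℕ × E => monomial (p.1 : ℤ) p.2) := by
  have hlin : ∀ (n : ℤ) (x : E), monomial n x
      = ((shift n).toLinearMap ∘ₗ (constL E).toLinearMap) x :=
    fun _ _ => rfl
  ext q
  rw [SetLike.mem_coe]
  constructor
  · rw [mem_polynomials_iff]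
    rintro ⟨n, x, rfl⟩
    exact Submodule.sum_mem _ fun k _ => Submodule.subset_span ⟨(k, x k), rfl⟩
  · intro hq
    induction hq using Submodule.span_induction with
    | mem q hq => obtain ⟨p, rfl⟩ := hq; exact monomial_mem_polynomials p.1 p.2
    | zero => exact mem_polynomials_iff.2 ⟨0, 0, by simp⟩
    | add p q _ _ hp hq =>
      obtain ⟨m, x, rfl⟩ := mem_polynomials_iff.1 hp
      obtain ⟨n, y, rfl⟩ := mem_polynomials_iff.1 hq
      -- Both coefficient lists are padded with zeros to the common length `m + n`.
      have hpad : ∀ (m n : ℕ) (x : ℕ → E), ∑ k ∈ Finset.range m, monomial (k : ℤ) (x k)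
          = ∑ k ∈ Finset.range (m + n), monomial (k : ℤ) (if k < m then x k else 0) := by
        intro m n x
        rw [Finset.sum_range_add]
        have h1 : ∑ k ∈ Finset.range n,
            monomial ((m + k : ℕ) : ℤ) (if m + k < m then x (m + k) else 0) = 0 :=
          Finset.sum_eq_zero fun k _ => by simp [hlin]
        rw [h1, add_zero]
        refine Finset.sum_congr rfl fun k hk => ?_
        rw [if_pos (Finset.mem_range.1 hk)]
      refine mem_polynomials_iff.2 ⟨m + n, fun k => (if k < m then x k else 0)
        + (if k < n then y k else 0), ?_⟩
      rw [hpad m n x, hpad n m y, add_comm n m, ← Finset.sum_add_distrib]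
      exact Finset.sum_congr rfl fun k _ => by simp only [hlin, map_add]
    | smul c q _ hq =>
      obtain ⟨n, y, rfl⟩ := mem_polynomials_iff.1 hq
      refine mem_polynomials_iff.2 ⟨n, fun k => c • y k, ?_⟩
      rw [Finset.smul_sum]
      exact Finset.sum_congr rfl fun k _ => by simp only [hlin, map_smul]

variable [CompleteSpace E]

/-- This turns vanishing of Fourier coefficients into orthogonality to monomials, so that
projections become available. -/
theorem inner_monomial (n : ℤ) (x : E) (f : L2 E) :
    inner ℂ (monomial n x) f = inner ℂ x (fourierCoeff (f : Circ → E) n) := by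
  rw [L2.inner_def, fourierCoeff, ← integral_inner ((integrable_L2 f).fourier_smul _)]
  refine integral_congr_ae ?_
  filter_upwards [coeFn_monomial n x] with t ht
  rw [ht, inner_smul_left, inner_smul_right, fourier_neg]

theorem fourierCoeff_eq_zero_iff {n : ℤ} {f : L2 E} :
    fourierCoeff (f : Circ → E) n = 0 ↔ ∀ x : E, inner ℂ (monomial n x) f = 0 := by
  refine ⟨fun h x => by rw [inner_monomial, h, inner_zero_right], fun h => ?_⟩
  rw [← inner_self_eq_zero (𝕜 := ℂ), ← inner_monomial, h]

theorem eq_zero_of_fourierCoeff {f : L2 E} (h : ∀ n, fourierCoeff (f : Circ → E) n = 0) : f = 0 :=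
  (Lp.eq_zero_iff_ae_eq_zero).2 (ae_eq_zero_of_fourierCoeff_eq_zero (integrable_L2 f) h)

theorem fourierCoeff_monomial_of_ne {m n : ℤ} (h : n ≠ m) (x : E) :
    fourierCoeff (monomial m x : Circ → E) n = 0 := by
  rw [fourierCoeff_congr_ae (coeFn_monomial m x)]
  have hint : Integrable (fun t : Circ => (fourier m t : ℂ)) haar :=
    (integrable_const (1 : ℂ)).fourier_smul m |>.congr (ae_of_all _ fun t => by simp)
  have := (ContinuousLinearMap.toSpanSingleton ℂ x).fourierCoeff_comp hint n
  simp only [ContinuousLinearMap.toSpanSingleton_apply] at this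
  rw [this]
  have h2 : fourierCoeff (fun t : Circ => (fourier m t : ℂ)) n = 0 := by
    rw [fourierCoeff_fourier, Pi.single_eq_of_ne h]
  rw [h2, zero_smul]

theorem monomial_mem_H2 {m : ℤ} (hm : 0 ≤ m) (x : E) : monomial m x ∈ H2 E :=
  fun _ hn => fourierCoeff_monomial_of_ne (by omega) x

theorem eq_zero_of_mem_H2_of_inner {f : L2 E} (hf : f ∈ H2 E)
    (h : ∀ (k : ℕ) (x : E), inner ℂ (monomial k x) f = 0) : f = 0 := by
  refine eq_zero_of_fourierCoeff fun n => ?_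
  rcases lt_or_ge n 0 with hn | hn
  · exact hf n hn
  · lift n to ℕ using hn
    exact fourierCoeff_eq_zero_iff.2 (h n)

/-- A closed subspace that contains the analytic monomials contains the Hardy space. -/
theorem H2_le_of_monomial_mem {K : Submodule ℂ (L2 E)} (hK : IsClosed (K : Set (L2 E)))
    (h : ∀ (k : ℕ) (x : E), monomial k x ∈ K) : H2 E ≤ K := by
  -- After intersecting with `H²`, the component of `f` orthogonal to `V` stays in `H²` and is
  -- orthogonal to every analytic monomial, hence zero.
  let V : Submodule ℂ (L2 E) := K ⊓ H2 E
  have hV : IsClosed (V : Set (L2 E)) := hK.inter (isClosed_H2 E)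
  have : CompleteSpace V := hV.completeSpace_coe
  intro f hf
  have h1 : f - V.starProjection f ∈ H2 E :=
    (H2 E).sub_mem hf (V.starProjection_apply_mem f).2
  have h2 : f - V.starProjection f = 0 := by
    refine eq_zero_of_mem_H2_of_inner h1 fun k x => ?_
    exact (V.mem_orthogonal _).1 (V.sub_starProjection_mem_orthogonal f) _
      ⟨h k x, monomial_mem_H2 (by positivity) x⟩
  rw [sub_eq_zero.1 h2]
  exact (V.starProjection_apply_mem f).1

end Shift

/-! ### Complex conjugation and transposes -/

section Conjugation

variable {ι κ : Type*}

@[simp] theorem conjMap_conjMap (x : Ell2 ι) : conjMap ι (conjMap ι x) = x := by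
  simp [conjMap]

theorem transposeOp_apply (A : Ell2 ι →L[ℂ] Ell2 κ) (x : Ell2 κ) :
    transposeOp A x = conjMap ι (ContinuousLinearMap.adjoint A (conjMap κ x)) := rfl

theorem conjOp_apply (A : Ell2 ι →L[ℂ] Ell2 κ) (x : Ell2 ι) :
    conjOp A x = conjMap κ (A (conjMap ι x)) := rfl

theorem inner_transposeOp_left (A : Ell2 ι →L[ℂ] Ell2 κ) (x : Ell2 κ) (y : Ell2 ι) :
    inner ℂ (transposeOp A x) y = inner ℂ (A (conjMap ι y)) (conjMap κ x) := by
  rw [transposeOp_apply, inner_conjMap_left, ContinuousLinearMap.adjoint_inner_right]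

theorem inner_transposeOp_right (A : Ell2 ι →L[ℂ] Ell2 κ) (x : Ell2 κ) (y : Ell2 ι) :
    inner ℂ y (transposeOp A x) = inner ℂ (conjMap κ x) (A (conjMap ι y)) := by
  rw [← inner_conj_symm, inner_transposeOp_left, inner_conj_symm]

/-- A closed subspace of `ℓ²(ι)` that contains the standard basis is everything. -/
theorem mem_of_single_mem [DecidableEq ι] {K : Submodule ℂ (Ell2 ι)}
    (hK : IsClosed (K : Set (Ell2 ι))) (h : ∀ i, lp.single 2 i (1 : ℂ) ∈ K) (x : Ell2 ι) :
    x ∈ K := by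
  refine hK.mem_of_tendsto (lp.hasSum_single (by norm_num) x)
    (Filter.Eventually.of_forall fun s => K.sum_mem fun i _ => ?_)
  have : (lp.single 2 i (x i) : Ell2 ι) = x i • lp.single 2 i (1 : ℂ) := by
    rw [← lp.single_smul]; simp
  rw [this]
  exact K.smul_mem _ (h i)

theorem eq_of_single_eq [DecidableEq ι] {F : Type*} [NormedAddCommGroup F] [NormedSpace ℂ F]
    {A B : Ell2 ι →L[ℂ] F}
    (h : ∀ i, A (lp.single 2 i (1 : ℂ)) = B (lp.single 2 i (1 : ℂ))) : A = B := by
  ext1 x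
  have hK : IsClosed (LinearMap.ker (A - B).toLinearMap : Set (Ell2 ι)) := (A - B).isClosed_ker
  have := mem_of_single_mem hK (fun i => by simp [h i]) x
  simpa [sub_eq_zero] using this

/-- Pointwise conjugation on `L²(ℓ²(ι))`. -/
def conjL2 (f : L2 (Ell2 ι)) : L2 (Ell2 ι) := (conjMap ι).compLp f

theorem coeFn_conjL2 (f : L2 (Ell2 ι)) :
    (conjL2 f : Circ → Ell2 ι) =ᵐ[haar] fun t => conjMap ι (f t) :=
  ContinuousLinearMap.coeFn_compLp' _ _

theorem conjL2_conjL2 (f : L2 (Ell2 ι)) : conjL2 (conjL2 f) = f := by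
  refine Lp.ext ?_
  filter_upwards [coeFn_conjL2 f, coeFn_conjL2 (conjL2 f)] with t h1 h2
  rw [h2, h1, conjMap_conjMap]

theorem conjL2_monomial (n : ℤ) (x : Ell2 ι) :
    conjL2 (monomial n x) = monomial (-n) (conjMap ι x) := by
  refine Lp.ext ?_
  filter_upwards [coeFn_conjL2 (monomial n x), coeFn_monomial n x,
    coeFn_monomial (-n) (conjMap ι x)] with t h1 h2 h3
  rw [h1, h2, h3, map_smulₛₗ, fourier_neg]

theorem inner_conjL2_conjL2 (f g : L2 (Ell2 ι)) :
    inner ℂ (conjL2 f) (conjL2 g) = inner ℂ g f := by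
  rw [L2.inner_def, L2.inner_def]
  refine integral_congr_ae ?_
  filter_upwards [coeFn_conjL2 f, coeFn_conjL2 g] with t h1 h2
  rw [h1, h2, inner_conjMap]

/-- Conjugation maps `ζⁿ x` to `ζ⁻ⁿ x̄` and swaps the arguments of the inner product, so it reflects
the spectrum. -/
theorem fourierCoeff_conjL2_eq_zero_iff {f : L2 (Ell2 ι)} {n : ℤ} :
    fourierCoeff (conjL2 f : Circ → Ell2 ι) n = 0
      ↔ fourierCoeff (f : Circ → Ell2 ι) (-n) = 0 := by
  have key : ∀ x : Ell2 ι, inner ℂ (monomial n x) (conjL2 f)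
      = inner ℂ f (monomial (-n) (conjMap ι x)) := by
    intro x
    rw [← conjL2_monomial, ← inner_conjL2_conjL2 (conjL2 f), conjL2_conjL2]
  simp only [fourierCoeff_eq_zero_iff, key]
  constructor
  · intro h x
    rw [← inner_conj_symm, ← conjMap_conjMap x, h, map_zero]
  · intro h x
    rw [← inner_conj_symm, h, map_zero]

end Conjugation

/-! ### Multiplication operators, kernels of analytic Toeplitz operators, co-outerness -/

namespace MatFun

variable {ι κ : Type*}

theorem coeFn_mulOp [Countable κ] (Φ : MatFun ι κ) (f : L2 (Ell2 ι)) :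
    (Φ.mulOp f : Circ → Ell2 κ) =ᵐ[haar] fun t => Φ.toFun t (f t) :=
  (Φ.memLp_mul f).coeFn_toLp

theorem continuous_mulOp [Countable κ] (Φ : MatFun ι κ) : Continuous Φ.mulOp := by
  obtain ⟨C, hC⟩ := Φ.bounded
  refine (Φ.mulOp.mkContinuous C fun f => ?_).continuous
  refine Lp.norm_le_mul_norm_of_ae_le_mul ?_
  filter_upwards [hC, coeFn_mulOp Φ f] with t h1 h2
  rw [h2]
  exact ((Φ.toFun t).le_opNorm _).trans (mul_le_mul_of_nonneg_right h1 (norm_nonneg _))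

theorem mulOp_shift [Countable κ] (Φ : MatFun ι κ) (m : ℤ) (f : L2 (Ell2 ι)) :
    Φ.mulOp (shift m f) = shift m (Φ.mulOp f) := by
  refine Lp.ext ?_
  filter_upwards [coeFn_mulOp Φ f, coeFn_mulOp Φ (shift m f), coeFn_shift m f,
    coeFn_shift m (Φ.mulOp f)] with t h1 h2 h3 h4
  rw [h2, h3, h4, h1, map_smul]

theorem coeFn_mulOp_const [Countable κ] (Φ : MatFun ι κ) (x : Ell2 ι) :
    (Φ.mulOp (const x) : Circ → Ell2 κ) =ᵐ[haar] fun t => Φ.toFun t x := by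
  filter_upwards [coeFn_mulOp Φ (const x), coeFn_const x] with t h1 h2
  rw [h1, h2]

theorem isAnalytic_iff [Countable κ] (Φ : MatFun ι κ) :
    Φ.IsAnalytic ↔ ∀ x, Φ.mulOp (const x) ∈ H2 (Ell2 κ) := by
  refine forall_congr' fun x => ?_
  rw [mem_H2, fourierCoeff_congr_ae (coeFn_mulOp_const Φ x)]

/-- Multiplication by an analytic function preserves the Hardy space. -/
theorem IsAnalytic.mulOp_mem_H2 [Countable κ] {Φ : MatFun ι κ} (hΦ : Φ.IsAnalytic)
    {f : L2 (Ell2 ι)} (hf : f ∈ H2 (Ell2 ι)) : Φ.mulOp f ∈ H2 (Ell2 κ) := by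
  refine H2_le_of_monomial_mem (K := (H2 (Ell2 κ)).comap Φ.mulOp)
    ((isClosed_H2 _).preimage Φ.continuous_mulOp) (fun k x => ?_) hf
  rw [Submodule.mem_comap, monomial, mulOp_shift]
  exact shift_mem_H2 (by positivity) (Φ.isAnalytic_iff.1 hΦ x)

theorem IsAnalytic.mem_toeplitzKer [Countable κ] {Φ : MatFun ι κ} (hΦ : Φ.IsAnalytic)
    {f : L2 (Ell2 ι)} : f ∈ Φ.toeplitzKer ↔ f ∈ H2 (Ell2 ι) ∧ Φ.mulOp f = 0 := by
  rw [toeplitzKer, Submodule.mem_map]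
  constructor
  · rintro ⟨g, hg, rfl⟩
    refine ⟨g.2, ?_⟩
    have h1 : (H2 (Ell2 κ)).orthogonalProjectionOnto (Φ.mulOp g) = 0 := hg
    have h2 := Submodule.orthogonalProjectionOnto_mem_subspace_eq_self
      (K := H2 (Ell2 κ)) ⟨Φ.mulOp g, hΦ.mulOp_mem_H2 g.2⟩
    rw [h1] at h2
    exact (congrArg Subtype.val h2).symm
  · rintro ⟨hf, h0⟩
    refine ⟨⟨f, hf⟩, ?_, rfl⟩
    rw [LinearMap.mem_ker]
    change (H2 (Ell2 κ)).orthogonalProjectionOnto (Φ.mulOp f) = 0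
    rw [h0, map_zero]

/-- Transposition moves entries without conjugating them: pairing `Φᵗ x` with `y` equals pairing `Φ
ȳ` with `x̄`. -/
theorem IsAnalytic.transpose [Countable ι] [Countable κ] {Φ : MatFun ι κ} (hΦ : Φ.IsAnalytic) :
    Φ.transpose.IsAnalytic := by
  rw [isAnalytic_iff]
  intro x n hn
  rw [fourierCoeff_congr_ae (coeFn_mulOp_const _ _)]
  have hint : Integrable (fun t => Φ.transpose.toFun t x) haar :=
    (integrable_L2 (Φ.transpose.mulOp (const x))).congr (coeFn_mulOp_const _ _)
  have hint' : ∀ y, Integrable (fun t => Φ.toFun t y) haar := fun y =>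
    (integrable_L2 (Φ.mulOp (const y))).congr (coeFn_mulOp_const _ _)
  refine ext_inner_left ℂ fun y => ?_
  rw [inner_zero_right]
  have h1 := (innerSL ℂ y).fourierCoeff_comp hint n
  have h2 := (innerSL ℂ (conjMap κ x)).fourierCoeff_comp (hint' (conjMap ι y)) n
  rw [hΦ _ n hn, map_zero] at h2
  rw [innerSL_apply_apply] at h1
  rw [← h1, ← h2]
  congr 1
  funext t
  exact inner_transposeOp_right _ _ _

/-- Orthogonality to the range of `Φᵗ` is thereby read off from the Fourier coefficients of `Φ ḡ`.
-/
theorem inner_transpose_mulOp [Countable ι] [Countable κ] (Φ : MatFun ι κ) (q : L2 (Ell2 κ))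
    (g : L2 (Ell2 ι)) :
    inner ℂ (Φ.transpose.mulOp q) g = inner ℂ (Φ.mulOp (conjL2 g)) (conjL2 q) := by
  rw [L2.inner_def, L2.inner_def]
  refine integral_congr_ae ?_
  filter_upwards [coeFn_mulOp Φ.transpose q, coeFn_mulOp Φ (conjL2 g), coeFn_conjL2 g,
    coeFn_conjL2 q] with t h1 h2 h3 h4
  rw [h1, h2, h3, h4]
  exact inner_transposeOp_left _ _ _

theorem norm_mulOp [Countable κ] {Φ : MatFun ι κ}
    (hΦ : ∀ᵐ t ∂haar, (ContinuousLinearMap.adjoint (Φ.toFun t)).comp (Φ.toFun t)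
      = ContinuousLinearMap.id ℂ (Ell2 ι)) (f : L2 (Ell2 ι)) : ‖Φ.mulOp f‖ = ‖f‖ := by
  rw [Lp.norm_def, Lp.norm_def]
  congr 1
  refine eLpNorm_congr_norm_ae ?_
  filter_upwards [coeFn_mulOp Φ f, hΦ] with t h1 h2
  rw [h1]
  exact ((Φ.toFun t).norm_map_iff_adjoint_comp_self.2 h2) _

theorem IsInner.mulOp_injective [Countable κ] {Φ : MatFun ι κ} (hΦ : Φ.IsInner) :
    Function.Injective Φ.mulOp := by
  refine (injective_iff_map_eq_zero _).2 fun f hf => ?_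
  rw [← norm_eq_zero, ← norm_mulOp hΦ.2, hf, norm_zero]

/-- If `Θ` maps the Hardy space into the kernel of multiplication by `Ψ`, then `Ψ Θ = 0`. -/
theorem ae_comp_eq_zero {μ : Type*} [Countable ι] [Countable κ] [Countable μ]
    {Θ : MatFun ι κ} {Ψ : MatFun κ μ} (hΨ : Ψ.IsAnalytic)
    (h : Θ.rangeH2 ≤ Ψ.toeplitzKer) :
    ∀ᵐ t ∂haar, (Ψ.toFun t).comp (Θ.toFun t) = 0 := by
  classical
  have h1 : ∀ i : ι, ∀ᵐ t ∂haar, Ψ.toFun t (Θ.toFun t (lp.single 2 i (1 : ℂ))) = 0 := by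
    intro i
    have h2 : Ψ.mulOp (Θ.mulOp (const (lp.single 2 i (1 : ℂ)))) = 0 := by
      refine (hΨ.mem_toeplitzKer.1 (h ⟨_, ?_, rfl⟩)).2
      exact monomial_zero (lp.single 2 i (1 : ℂ) : Ell2 ι) ▸ monomial_mem_H2 le_rfl _
    filter_upwards [coeFn_mulOp Ψ (Θ.mulOp (const (lp.single 2 i (1 : ℂ)))),
      coeFn_mulOp_const Θ (lp.single 2 i (1 : ℂ)), (Lp.eq_zero_iff_ae_eq_zero).1 h2]
      with t h3 h4 h5
    rw [← h4, ← h3, h5, Pi.zero_apply]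
  filter_upwards [ae_all_iff.2 h1] with t ht
  exact eq_of_single_eq fun i => by simpa using ht i

/-- If the range of an inner function `Θ` on the Hardy space is the kernel of the Toeplitz operator
of an analytic function, then `Θ` is co-outer. -/
theorem IsInner.isCoOuter_of_rangeH2_eq {μ : Type*} [Countable ι] [Countable κ] [Countable μ]
    {Θ : MatFun ι κ} (hΘ : Θ.IsInner) {Ψ : MatFun κ μ} (hΨ : Ψ.IsAnalytic)
    (h : Ψ.toeplitzKer = Θ.rangeH2) : Θ.IsCoOuter := by
  -- As `Ψ Θ = 0` pointwise, this holds on all of `L²`; it is needed for `ζ⁻¹ ḡ` before that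
  -- function is known to be analytic.
  have hker : ∀ f : L2 (Ell2 ι), Ψ.mulOp (Θ.mulOp f) = 0 := by
    intro f
    refine (Lp.eq_zero_iff_ae_eq_zero).2 ?_
    filter_upwards [ae_comp_eq_zero hΨ h.ge, coeFn_mulOp Ψ (Θ.mulOp f), coeFn_mulOp Θ f]
      with t h1 h2 h3
    rw [h2, h3]
    exact DFunLike.congr_fun h1 (f t)
  have hΘt := hΘ.1.transpose
  refine ⟨hΘt, ?_⟩
  let Q : Submodule ℂ (L2 (Ell2 ι)) :=
    (Submodule.span ℂ (Set.range fun p : ℕ × Ell2 κ => monomial (p.1 : ℤ) p.2)).map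
      Θ.transpose.mulOp
  have hQ : Θ.transpose.mulOp '' polynomials (Ell2 κ) = Q := by
    rw [polynomials_eq_span]; rfl
  rw [hQ, ← Submodule.topologicalClosure_coe]
  congr 1
  have hle : Q.topologicalClosure ≤ H2 (Ell2 ι) := by
    refine Submodule.topologicalClosure_minimal _ ?_ (isClosed_H2 _)
    refine Submodule.map_le_iff_le_comap.2 (Submodule.span_le.2 ?_)
    rintro _ ⟨p, rfl⟩
    exact hΘt.mulOp_mem_H2 (monomial_mem_H2 (by positivity) _)
  refine le_antisymm hle fun f hf => ?_
  have : CompleteSpace Q.topologicalClosure := Q.isClosed_topologicalClosure.completeSpace_coe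
  set g := f - Q.topologicalClosure.starProjection f with hg
  have hgH : g ∈ H2 (Ell2 ι) :=
    (H2 _).sub_mem hf (hle (Q.topologicalClosure.starProjection_apply_mem f))
  have hgQ : ∀ (k : ℕ) (x : Ell2 κ), inner ℂ (Θ.transpose.mulOp (monomial k x)) g = 0 := by
    intro k x
    refine (Submodule.mem_orthogonal _ _).1
      (Q.topologicalClosure.sub_starProjection_mem_orthogonal f) _ (Q.le_topologicalClosure ?_)
    exact Submodule.mem_map_of_mem (Submodule.subset_span ⟨(k, x), rfl⟩)
  -- Orthogonality of `g` to `Θᵗ ζᵏ x` kills the coefficients of `Θ ḡ` of index `-k ≤ 0`; one factor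
  -- `ζ⁻¹` can therefore be spared.
  have h1 : Θ.mulOp (shift (-1) (conjL2 g)) ∈ H2 (Ell2 κ) := by
    intro n hn
    rw [mulOp_shift, fourierCoeff_shift, fourierCoeff_eq_zero_iff]
    intro x
    obtain ⟨k, hk⟩ := Int.eq_ofNat_of_zero_le (show 0 ≤ -(n - -1) by omega)
    have h2 := hgQ k (conjMap κ x)
    rw [inner_transpose_mulOp, conjL2_monomial, conjMap_conjMap, ← hk, neg_neg] at h2
    rw [← inner_conj_symm, h2, map_zero]
  have h2 : shift (-1) (conjL2 g) ∈ H2 (Ell2 ι) := by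
    have h3 : Θ.mulOp (shift (-1) (conjL2 g)) ∈ Θ.rangeH2 :=
      h ▸ hΨ.mem_toeplitzKer.2 ⟨h1, hker _⟩
    obtain ⟨u, hu, hu'⟩ := h3
    exact hΘ.mulOp_injective hu' ▸ hu
  -- The coefficient of `g` at `n ≥ 0` sits, up to conjugation, at index `-n - 1 < 0` of `ζ⁻¹ ḡ ∈
  -- H²`.
  have h3 : g = 0 := by
    refine eq_zero_of_fourierCoeff fun n => ?_
    rcases lt_or_ge n 0 with hn | hn
    · exact hgH n hn
    · have h4 := h2 (-n - 1) (by omega)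
      rwa [fourierCoeff_shift, show -n - 1 - -1 = -n by ring, fourierCoeff_conjL2_eq_zero_iff,
        neg_neg] at h4
  rw [sub_eq_zero.1 (hg.symm.trans h3)]
  exact Q.topologicalClosure.starProjection_apply_mem f

end MatFun

/-! ### The algebra of scalar bounded analytic functions -/

section BoundedAnalytic

theorem memLp_smul_const {E : Type*} [NormedAddCommGroup E] [NormedSpace ℂ E] {f : Circ → ℂ}
    (hf : AEStronglyMeasurable f haar) (hC : ∃ C : ℝ, ∀ᵐ t ∂haar, ‖f t‖ ≤ C) (x : E) :
    MemLp (fun t => f t • x) 2 haar := by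
  obtain ⟨C, hC⟩ := hC
  refine MemLp.of_bound (hf.smul_const x) (C * ‖x‖) ?_
  filter_upwards [hC] with t ht
  rw [norm_smul]
  exact mul_le_mul_of_nonneg_right ht (norm_nonneg _)

theorem integrable_of_bounded {f : Circ → ℂ} (hf : AEStronglyMeasurable f haar)
    (hC : ∃ C : ℝ, ∀ᵐ t ∂haar, ‖f t‖ ≤ C) : Integrable f haar := by
  obtain ⟨C, hC⟩ := hC
  exact (integrable_const C).mono' hf hC

theorem fourierCoeff_smul_const {E : Type*} [NormedAddCommGroup E] [NormedSpace ℂ E]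
    [CompleteSpace E] {f : Circ → ℂ} (hf : Integrable f haar) (x : E) (n : ℤ) :
    fourierCoeff (fun t => f t • x) n = fourierCoeff f n • x := by
  simpa using (ContinuousLinearMap.toSpanSingleton ℂ x).fourierCoeff_comp hf n

/-- The matrix function `f I`, for a scalar function `f`. -/
def MatFun.scalar (ι : Type*) (f : Circ → ℂ) (hf : AEStronglyMeasurable f haar)
    (hC : ∃ C : ℝ, ∀ᵐ t ∂haar, ‖f t‖ ≤ C) : MatFun ι ι where
  toFun t := f t • ContinuousLinearMap.id ℂ (Ell2 ι)
  weaklyMeasurable x y := by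
    simpa [inner_smul_right] using hf.mul_const (inner ℂ y x)
  bounded := by
    obtain ⟨C, hC⟩ := hC
    refine ⟨C, hC.mono fun t ht => ?_⟩
    rw [norm_smul]
    exact (mul_le_of_le_one_right (norm_nonneg _) ContinuousLinearMap.norm_id_le).trans ht

/-- With `f` viewed as a `1 × 1` analytic matrix function acting on `g e ∈ H²`, this is an instance
of `IsAnalytic.mulOp_mem_H2`. -/
theorem fourierCoeff_mul_eq_zero {f g : Circ → ℂ} (hf : AEStronglyMeasurable f haar)
    (hfC : ∃ C : ℝ, ∀ᵐ t ∂haar, ‖f t‖ ≤ C) (hf0 : ∀ n : ℤ, n < 0 → fourierCoeff f n = 0)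
    (hg : AEStronglyMeasurable g haar) (hgC : ∃ C : ℝ, ∀ᵐ t ∂haar, ‖g t‖ ≤ C)
    (hg0 : ∀ n : ℤ, n < 0 → fourierCoeff g n = 0) (n : ℤ) (hn : n < 0) :
    fourierCoeff (f * g) n = 0 := by
  let e : Ell2 Unit := lp.single 2 () (1 : ℂ)
  have he : e ≠ 0 := fun h => by
    have := congrArg (fun x : Ell2 Unit => x ()) h
    simp [e] at this
  let F := MatFun.scalar Unit f hf hfC
  have hF : F.IsAnalytic := by
    intro x n hn
    change fourierCoeff (fun t => f t • x) n = 0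
    rw [fourierCoeff_smul_const (integrable_of_bounded hf hfC), hf0 n hn, zero_smul]
  have hG : (memLp_smul_const hg hgC e).toLp _ ∈ H2 (Ell2 Unit) := by
    rw [toLp_mem_H2]
    intro n hn
    rw [fourierCoeff_smul_const (integrable_of_bounded hg hgC), hg0 n hn, zero_smul]
  have h1 := hF.mulOp_mem_H2 hG n hn
  have h2 : (F.mulOp ((memLp_smul_const hg hgC e).toLp _) : Circ → Ell2 Unit)
      =ᵐ[haar] fun t => (f * g) t • e := by
    filter_upwards [F.coeFn_mulOp ((memLp_smul_const hg hgC e).toLp _),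
      (memLp_smul_const hg hgC e).coeFn_toLp] with t h3 h4
    rw [h3, h4]
    change f t • g t • e = (f t * g t) • e
    rw [smul_smul]
  have h3 : Integrable (f * g) haar := by
    obtain ⟨C, hC⟩ := hfC
    exact (integrable_of_bounded hg hgC).bdd_mul hf hC
  rw [fourierCoeff_congr_ae h2, fourierCoeff_smul_const h3] at h1
  exact (smul_eq_zero.1 h1).resolve_right he

/-- The algebra of (boundary values of) bounded analytic functions. -/
def Hinf : Subalgebra ℂ (Circ → ℂ) where
  carrier := {f | AEStronglyMeasurable f haar ∧ (∃ C : ℝ, ∀ᵐ t ∂haar, ‖f t‖ ≤ C) ∧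
    ∀ n : ℤ, n < 0 → fourierCoeff f n = 0}
  mul_mem' := by
    rintro f g ⟨hf, ⟨C, hC⟩, hf0⟩ ⟨hg, ⟨D, hD⟩, hg0⟩
    refine ⟨hf.mul hg, ⟨C * D, ?_⟩,
      fourierCoeff_mul_eq_zero hf ⟨C, hC⟩ hf0 hg ⟨D, hD⟩ hg0⟩
    filter_upwards [hC, hD] with t h1 h2
    rw [Pi.mul_apply, norm_mul]
    exact mul_le_mul h1 h2 (norm_nonneg _) ((norm_nonneg _).trans h1)
  add_mem' := by
    rintro f g ⟨hf, ⟨C, hC⟩, hf0⟩ ⟨hg, ⟨D, hD⟩, hg0⟩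
    refine ⟨hf.add hg, ⟨C + D, ?_⟩, fun n hn => ?_⟩
    · filter_upwards [hC, hD] with t h1 h2
      exact norm_add_le_of_le h1 h2
    · rw [fourierCoeff.add (integrable_of_bounded hf ⟨C, hC⟩) (integrable_of_bounded hg ⟨D, hD⟩),
        Pi.add_apply, hf0 n hn, hg0 n hn, add_zero]
  algebraMap_mem' := by
    intro c
    refine ⟨aestronglyMeasurable_const, ⟨‖c‖, ae_of_all _ fun t => le_rfl⟩, fun n hn => ?_⟩
    have h1 : (algebraMap ℂ (Circ → ℂ) c) = c • (fun t : Circ => (fourier 0 t : ℂ)) := by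
      funext t; simp
    rw [h1, fourierCoeff.const_smul, fourierCoeff_fourier, Pi.single_eq_of_ne hn.ne, smul_zero]

theorem det_mem_Hinf {m : Type*} [Fintype m] [DecidableEq m] {M : Circ → Matrix m m ℂ}
    (hM : ∀ i j, (fun t => M t i j) ∈ Hinf) : (fun t => (M t).det) ∈ Hinf := by
  have : (fun t => (M t).det) = ∑ σ : Equiv.Perm m, Equiv.Perm.sign σ •
      ∏ i, fun t => M t (σ i) i := by
    funext t
    simp [Matrix.det_apply]
  rw [this]
  exact sum_mem fun σ _ => zsmul_mem (prod_mem fun i _ => hM _ _) _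

theorem MatFun.IsAnalytic.inner_mem_Hinf {ι κ : Type*} [Countable κ] {Φ : MatFun ι κ}
    (hΦ : Φ.IsAnalytic) (x : Ell2 ι) (y : Ell2 κ) :
    (fun t => inner ℂ y (Φ.toFun t x)) ∈ Hinf := by
  refine ⟨Φ.weaklyMeasurable x y, ?_, fun n hn => ?_⟩
  · obtain ⟨C, hC⟩ := Φ.bounded
    refine ⟨‖y‖ * (C * ‖x‖), hC.mono fun t ht => (norm_inner_le_norm _ _).trans ?_⟩
    refine mul_le_mul_of_nonneg_left (((Φ.toFun t).le_opNorm x).trans ?_) (norm_nonneg _)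
    exact mul_le_mul_of_nonneg_right ht (norm_nonneg _)
  · have hint : Integrable (fun t => Φ.toFun t x) haar :=
      (integrable_L2 (Φ.mulOp (const x))).congr (Φ.coeFn_mulOp_const x)
    have h1 := (innerSL ℂ y).fourierCoeff_comp hint n
    rwa [hΦ x n hn, map_zero] at h1

theorem exists_mem_H2_of_mem_Hinf {E : Type*} [NormedAddCommGroup E] [InnerProductSpace ℂ E]
    [CompleteSpace E] {f : Circ → ℂ} (hf : f ∈ Hinf) (x : E) :
    ∃ F ∈ H2 E, (F : Circ → E) =ᵐ[haar] fun t => f t • x := by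
  refine ⟨(memLp_smul_const hf.1 hf.2.1 x).toLp _, ?_, MemLp.coeFn_toLp _⟩
  rw [toLp_mem_H2]
  intro n hn
  rw [fourierCoeff_smul_const (integrable_of_bounded hf.1 hf.2.1), hf.2.2 n hn, zero_smul]

end BoundedAnalytic

/-! ### Cramer's rule for kernels of operators with finitely many rows -/

section Cramer

variable {κ m : Type*} [DecidableEq κ] [Fintype m] [DecidableEq m]

/-- The square submatrix of the matrix of `A` whose columns are listed by `J`. -/
def columns (A : Ell2 κ →L[ℂ] Ell2 m) (J : m → κ) : Matrix m m ℂ :=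
  Matrix.of fun i j => A (lp.single 2 (J j) (1 : ℂ)) i

/-- The map from `ℓ²(κ)` to the kernel of `A` given by Cramer's rule for the columns listed by
`J`. -/
def cramerMap (A : Ell2 κ →L[ℂ] Ell2 m) (J : m → κ) : Ell2 κ →ₗ[ℂ] Ell2 κ where
  toFun v := (columns A J).det • v
    - ∑ i, (columns A J).cramer (A v) i • (lp.single 2 (J i) (1 : ℂ) : Ell2 κ)
  map_add' v w := by
    simp only [map_add, lp.coeFn_add, Pi.add_apply, add_smul, smul_add, Finset.sum_add_distrib]
    abel
  map_smul' c v := by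
    simp only [map_smul, lp.coeFn_smul, Pi.smul_apply, RingHom.id_apply, smul_sub,
      Finset.smul_sum, smul_assoc, smul_comm c]

theorem cramerMap_apply (A : Ell2 κ →L[ℂ] Ell2 m) (J : m → κ) (v : Ell2 κ) :
    cramerMap A J v = (columns A J).det • v
      - ∑ i, (columns A J).cramer (A v) i • (lp.single 2 (J i) (1 : ℂ) : Ell2 κ) := rfl

/-- Cramer's identity says that the chosen columns, weighted by `cramer (A v)`, add up to `det • A
v`, which cancels the first term. -/
theorem apply_cramerMap (A : Ell2 κ →L[ℂ] Ell2 m) (J : m → κ) (v : Ell2 κ) :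
    A (cramerMap A J v) = 0 := by
  ext i
  have h := congrFun (Matrix.mulVec_cramer (columns A J) (A v)) i
  have h' : ∑ j, A (lp.single 2 (J j) (1 : ℂ)) i * (columns A J).cramer (A v) j
      = (columns A J).det * A v i := h
  rw [cramerMap_apply, map_sub, map_sum, map_smul, lp.coeFn_sub, Pi.sub_apply, lp.coeFn_sum,
    Finset.sum_apply, lp.coeFn_smul, Pi.smul_apply, smul_eq_mul, ← h', lp.coeFn_zero,
    Pi.zero_apply, sub_eq_zero]
  exact Finset.sum_congr rfl fun j _ => by
    rw [map_smul, lp.coeFn_smul, Pi.smul_apply, smul_eq_mul, mul_comm]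

/-- So if the minor is nonzero, `cramerMap` reaches every vector of the kernel. -/
theorem cramerMap_of_apply_eq_zero {A : Ell2 κ →L[ℂ] Ell2 m} (J : m → κ) {v : Ell2 κ}
    (hv : A v = 0) : cramerMap A J v = (columns A J).det • v := by
  have h0 : (columns A J).cramer (A v) = 0 := by
    rw [hv]; exact map_zero _
  simp [cramerMap_apply, h0]

theorem continuous_cramerMap (A : Ell2 κ →L[ℂ] Ell2 m) (J : m → κ) :
    Continuous (cramerMap A J) := by
  have hcoe : Continuous fun x : Ell2 m => (x : m → ℂ) :=
    continuous_pi fun i => (lp.evalCLM ℂ (fun _ : m => ℂ) 2 i).continuous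
  have hc : Continuous fun v => (columns A J).cramer (A v) :=
    (LinearMap.continuous_of_finiteDimensional (columns A J).cramer).comp
      (hcoe.comp A.continuous)
  have h1 : Continuous fun v : Ell2 κ => (columns A J).det • v :=
    continuous_const_smul _
  exact h1.sub (continuous_finsetSum _ fun i _ =>
    ((continuous_apply i).comp hc).smul continuous_const)

/-- The columns span a subspace that is closed, being finite-dimensional, hence contains the whole
range of `A`; a basis extracted from them gives `J`. -/
theorem exists_det_columns_ne_zero {A : Ell2 κ →L[ℂ] Ell2 m} (hA : Function.Surjective A) :
    ∃ J : m → κ, (columns A J).det ≠ 0 := by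
  let φ : Ell2 κ →ₗ[ℂ] (m → ℂ) :=
    { toFun := fun v => A v
      map_add' := fun v w => by rw [map_add]; rfl
      map_smul' := fun c v => by rw [map_smul]; rfl }
  let s : Set (m → ℂ) := Set.range fun k => φ (lp.single 2 k (1 : ℂ))
  have hs : Submodule.span ℂ s = ⊤ := by
    rw [eq_top_iff]
    intro y _
    obtain ⟨v, hv⟩ := hA (∑ i, y i • lp.single 2 i (1 : ℂ))
    have hy : φ v = y := by
      funext j
      change A v j = y j
      rw [hv, lp.coeFn_sum, Finset.sum_apply, Finset.sum_eq_single j]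
      · simp
      · intro i _ hi
        simp [Pi.single_eq_of_ne hi.symm]
      · simp
    rw [← hy]
    have hφ : Continuous φ := continuous_pi fun i =>
      (lp.evalCLM ℂ (fun _ : m => ℂ) 2 i).continuous.comp A.continuous
    exact mem_of_single_mem (K := (Submodule.span ℂ s).comap φ)
      ((Submodule.closed_of_finiteDimensional (Submodule.span ℂ s)).preimage hφ)
      (fun k => Submodule.subset_span ⟨k, rfl⟩) v
  obtain ⟨f, hf, hspan, hli⟩ := Submodule.exists_fun_fin_finrank_span_eq ℂ s
  have hcard : Fintype.card m = Module.finrank ℂ (Submodule.span ℂ s) := by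
    rw [hs, finrank_top, Module.finrank_pi]
  let e : m ≃ Fin (Module.finrank ℂ (Submodule.span ℂ s)) :=
    Fintype.equivFinOfCardEq hcard
  choose g hg using hf
  refine ⟨fun j => g (e j), ?_⟩
  have hli' : LinearIndependent ℂ (columns A fun j => g (e j)).col := by
    have h1 := hli.comp e e.injective
    have h2 : (columns A fun j => g (e j)).col = f ∘ e := by
      funext j
      exact hg (e j)
    rw [h2]; exact h1
  exact (Matrix.isUnit_iff_isUnit_det _).1
    (Matrix.linearIndependent_cols_iff_isUnit.1 hli') |>.ne_zero

end Cramer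

/-! ### Pointwise kernels and unitary values -/

namespace MatFun

variable {ι κ m : Type*} [Fintype m] [DecidableEq m]

/-- Cramer's rule produces elements of the kernel of an analytic Toeplitz operator. -/
theorem IsAnalytic.exists_mem_toeplitzKer_cramerMap [DecidableEq κ] {Ψ : MatFun κ m}
    (hΨ : Ψ.IsAnalytic) (J : m → κ) (k : κ) :
    ∃ f ∈ Ψ.toeplitzKer, (f : Circ → Ell2 κ) =ᵐ[haar]
      fun t => cramerMap (Ψ.toFun t) J (lp.single 2 k (1 : ℂ)) := by
  have hentry : ∀ (x : Ell2 κ) (i : m), (fun t => Ψ.toFun t x i) ∈ Hinf := by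
    intro x i
    have := hΨ.inner_mem_Hinf x (lp.single 2 i (1 : ℂ))
    simpa [lp.inner_single_left] using this
  have hdet : (fun t => (columns (Ψ.toFun t) J).det) ∈ Hinf :=
    det_mem_Hinf fun i j => hentry _ i
  have hcr : ∀ i, (fun t => (columns (Ψ.toFun t) J).cramer
      (Ψ.toFun t (lp.single 2 k (1 : ℂ))) i) ∈ Hinf := by
    intro i
    simp only [Matrix.cramer_apply]
    refine det_mem_Hinf fun a b => ?_
    by_cases hb : b = i
    · subst hb
      simpa using hentry _ a
    · simpa [Matrix.updateCol_apply, hb, columns] using hentry (lp.single 2 (J b) (1 : ℂ)) a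
  obtain ⟨F, hF, hF'⟩ := exists_mem_H2_of_mem_Hinf hdet (lp.single 2 k (1 : ℂ) : Ell2 κ)
  choose G hG hG' using fun i => exists_mem_H2_of_mem_Hinf (hcr i)
    (lp.single 2 (J i) (1 : ℂ) : Ell2 κ)
  have hf : ((F - ∑ i, G i : L2 (Ell2 κ)) : Circ → Ell2 κ) =ᵐ[haar]
      fun t => cramerMap (Ψ.toFun t) J (lp.single 2 k (1 : ℂ)) := by
    filter_upwards [hF', ae_all_iff.2 hG', Lp.coeFn_sub F (∑ i, G i),
      coeFn_finset_sum Finset.univ G] with t h1 h2 h3 h4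
    rw [h3, Pi.sub_apply, h4, h1, cramerMap_apply]
    simp only [h2]
  refine ⟨F - ∑ i, G i, hΨ.mem_toeplitzKer.2 ⟨(H2 _).sub_mem hF ((H2 _).sum_mem fun i _ => hG i),
    (Lp.eq_zero_iff_ae_eq_zero).2 ?_⟩, hf⟩
  filter_upwards [hf, Ψ.coeFn_mulOp (F - ∑ i, G i)] with t h1 h2
  rw [h2, h1, apply_cramerMap, Pi.zero_apply]

/-- If `Ψ` has finitely many rows and surjective values, then the values of an inner function that
represents the kernel of its Toeplitz operator exhaust the pointwise kernels of `Ψ`. -/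
theorem IsAnalytic.ae_ker_le_range [Countable κ] {Ψ : MatFun κ m}
    (hΨ : Ψ.IsAnalytic) (hsurj : ∀ᵐ t ∂haar, Function.Surjective (Ψ.toFun t)) {Θ : MatFun ι κ}
    (hΘ : Θ.IsInner) (h : Ψ.toeplitzKer ≤ Θ.rangeH2) :
    ∀ᵐ t ∂haar, ∀ v, Ψ.toFun t v = 0 → ∃ u, Θ.toFun t u = v := by
  classical
  -- There are countably many pairs `(J, k)`, so one null set serves them all, although the `J` used
  -- below depends on `t`.
  have h1 : ∀ (J : m → κ) (k : κ), ∀ᵐ t ∂haar,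
      ∃ u, Θ.toFun t u = cramerMap (Ψ.toFun t) J (lp.single 2 k (1 : ℂ)) := by
    intro J k
    obtain ⟨f, hf, hf'⟩ := hΨ.exists_mem_toeplitzKer_cramerMap J k
    obtain ⟨u, _, rfl⟩ := h hf
    filter_upwards [hf', Θ.coeFn_mulOp u] with t h2 h3
    exact ⟨u t, by rw [← h3, h2]⟩
  filter_upwards [ae_all_iff.2 fun J => ae_all_iff.2 (h1 J), hsurj, hΘ.2] with t h2 h3 h4 v hv
  obtain ⟨J, hJ⟩ := exists_det_columns_ne_zero h3
  have hiso : Isometry (Θ.toFun t) := AddMonoidHomClass.isometry_of_norm _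
    ((Θ.toFun t).norm_map_iff_adjoint_comp_self.2 h4)
  have hclosed : IsClosed (LinearMap.range (Θ.toFun t).toLinearMap : Set (Ell2 κ)) :=
    hiso.isClosedEmbedding.isClosed_range
  -- The range of the isometry `Θ(t)` is closed, so membership extends from basis vectors to all
  -- `v`.
  have h5 := mem_of_single_mem
    (K := (LinearMap.range (Θ.toFun t).toLinearMap).comap (cramerMap (Ψ.toFun t) J))
    (hclosed.preimage (continuous_cramerMap _ J)) (fun k => h2 J k) v
  obtain ⟨u, hu⟩ := h5
  rw [cramerMap_of_apply_eq_zero J hv] at hu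
  refine ⟨(columns (Ψ.toFun t) J).det⁻¹ • u, ?_⟩
  have hu' : Θ.toFun t u = (columns (Ψ.toFun t) J).det • v := hu
  rw [map_smul, hu', smul_smul, inv_mul_cancel₀ hJ, one_smul]

end MatFun

/-- Two isometries `A` and `B` with `Aᵗ B = 0` and `Ker Aᵗ ⊆ Ran B` make up a unitary operator
`(A  conj B)`. -/
theorem isUnitaryOp_rowOp {ι ι' κ : Type*} {A : Ell2 ι →L[ℂ] Ell2 κ} {B : Ell2 ι' →L[ℂ] Ell2 κ}
    (hA : (ContinuousLinearMap.adjoint A).comp A = ContinuousLinearMap.id ℂ _)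
    (hB : (ContinuousLinearMap.adjoint B).comp B = ContinuousLinearMap.id ℂ _)
    (hAB : (transposeOp A).comp B = 0)
    (hker : ∀ v, transposeOp A v = 0 → ∃ u, B u = v) : IsUnitaryOp (rowOp A (conjOp B)) := by
  have hA' : ∀ x, ContinuousLinearMap.adjoint A (A x) = x := DFunLike.congr_fun hA
  have hB' : ∀ x, ContinuousLinearMap.adjoint B (B x) = x := DFunLike.congr_fun hB
  have hAB' : ∀ y, ContinuousLinearMap.adjoint A (conjOp B y) = 0 := by
    intro y
    have h1 : transposeOp A (B (conjMap ι' y)) = 0 := DFunLike.congr_fun hAB _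
    rw [transposeOp_apply] at h1
    rw [← conjMap_conjMap (ContinuousLinearMap.adjoint A (conjOp B y)), conjOp_apply, h1, map_zero]
  have hU : ∀ z, rowOp A (conjOp B) z = A z.fst + conjOp B z.snd := fun _ => rfl
  have hnorm : ∀ z, ‖rowOp A (conjOp B) z‖ = ‖z‖ := by
    intro z
    have hAn := A.norm_map_iff_adjoint_comp_self.2 hA z.fst
    have hBn : ‖conjOp B z.snd‖ = ‖z.snd‖ := by
      rw [conjOp_apply, norm_conjMap, B.norm_map_iff_adjoint_comp_self.2 hB, norm_conjMap]
    have horth : inner ℂ (A z.fst) (conjOp B z.snd) = 0 := by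
      rw [← ContinuousLinearMap.adjoint_inner_right, hAB', inner_zero_right]
    have h1 := norm_add_sq_eq_norm_sq_add_norm_sq_of_inner_eq_zero _ _ horth
    have h2 := WithLp.prod_norm_sq_eq_of_L2 z
    rw [hAn, hBn] at h1
    rw [← sq_eq_sq₀ (norm_nonneg _) (norm_nonneg _), hU, h2, sq, h1]
    ring
  have h1 := (rowOp A (conjOp B)).norm_map_iff_adjoint_comp_self.1 hnorm
  refine ⟨h1, ?_⟩
  have hsurj : Function.Surjective (rowOp A (conjOp B)) := by
    intro v
    -- The part of `v` orthogonal to `Ran A` lies in `Ker A*`; its conjugate lies in `Ker Aᵗ`, hence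
    -- in `Ran B`.
    have h2 : transposeOp A (conjMap κ (v - A (ContinuousLinearMap.adjoint A v))) = 0 := by
      rw [transposeOp_apply, conjMap_conjMap, map_sub, hA', sub_self, map_zero]
    obtain ⟨u, hu⟩ := hker _ h2
    refine ⟨WithLp.toLp 2 (ContinuousLinearMap.adjoint A v, conjMap ι' u), ?_⟩
    rw [hU]
    change A (ContinuousLinearMap.adjoint A v) + conjMap κ (B (conjMap ι' (conjMap ι' u))) = v
    rw [conjMap_conjMap, hu, conjMap_conjMap]
    abel
  ext1 v
  obtain ⟨z, rfl⟩ := hsurj v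
  exact congrArg (rowOp A (conjOp B)) (DFunLike.congr_fun h1 z)

namespace MatFun

/-- Conjugating `Υ* Υ = I` shows that the entrywise conjugate of `Υ` is a right inverse of `Υᵗ`. -/
theorem IsInner.ae_surjective_transpose {ι κ : Type*} [Countable κ] {Υ : MatFun ι κ}
    (hΥ : Υ.IsInner) : ∀ᵐ t ∂haar, Function.Surjective (Υ.transpose.toFun t) := by
  filter_upwards [hΥ.2] with t ht x
  refine ⟨conjMap κ (Υ.toFun t (conjMap ι x)), ?_⟩
  change transposeOp (Υ.toFun t) _ = x
  have h1 : ContinuousLinearMap.adjoint (Υ.toFun t) (Υ.toFun t (conjMap ι x)) = conjMap ι x :=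
    DFunLike.congr_fun ht _
  rw [transposeOp_apply, conjMap_conjMap, h1, conjMap_conjMap]

theorem IsInner.isUnitaryValued {ι κ m : Type*} [Countable κ] [Countable ι] [Finite m]
    {Υ : MatFun m κ} (hΥ : Υ.IsInner) {Θ : MatFun ι κ} (hΘ : Θ.IsInner)
    (h : Υ.transpose.toeplitzKer = Θ.rangeH2) : IsUnitaryValued Υ Θ := by
  classical
  have := Fintype.ofFinite m
  filter_upwards [hΥ.2, hΘ.2, ae_comp_eq_zero hΥ.1.transpose h.ge,
    hΥ.1.transpose.ae_ker_le_range hΥ.ae_surjective_transpose hΘ h.le] with t h1 h2 h3 h4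
  exact isUnitaryOp_rowOp h1 h2 h3 h4

end MatFun

/-- An orthonormal family in a separable Hilbert space is countable. -/
theorem _root_.Orthonormal.countable {α H : Type*} [NormedAddCommGroup H] [InnerProductSpace ℂ H]
    [TopologicalSpace.SeparableSpace H] {v : α → H} (hv : Orthonormal ℂ v) : Countable α := by
  -- The distance is `√2`, so the balls of radius `1/2` are disjoint.
  have hd : ∀ i j, i ≠ j → 1 < dist (v i) (v j) := by
    intro i j hij
    have h1 := norm_sub_sq (𝕜 := ℂ) (v i) (v j)
    rw [hv.2 hij, hv.1, hv.1] at h1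
    rw [dist_eq_norm]
    norm_num at h1
    nlinarith [norm_nonneg (v i - v j)]
  have h1 : (Set.univ : Set α).PairwiseDisjoint fun i => Metric.ball (v i) (1 / 2) := by
    intro i _ j _ hij
    refine Metric.ball_disjoint_ball ?_
    norm_num
    exact (hd i j hij).le
  refine Set.countable_univ_iff.1 (h1.countable_of_isOpen (fun _ _ => Metric.isOpen_ball)
    fun i _ => ⟨v i, Metric.mem_ball_self (by norm_num)⟩)

/-- Serves to make `L²(ℓ²(κ))` separable, so that bases of wandering subspaces are countable. -/
instance separableSpace_Ell2 {ι : Type*} [Countable ι] :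
    TopologicalSpace.SeparableSpace (Ell2 ι) := by
  classical
  let s : Set (Ell2 ι) := Set.range fun i => lp.single 2 i (1 : ℂ)
  have h1 : TopologicalSpace.IsSeparable (Submodule.span ℂ s : Set (Ell2 ι)) :=
    (Set.countable_range _).isSeparable.span
  rw [← TopologicalSpace.isSeparable_univ_iff]
  refine h1.closure.mono fun x _ => ?_
  exact mem_of_single_mem (K := (Submodule.span ℂ s).topologicalClosure)
    (Submodule.isClosed_topologicalClosure _)
    (fun i => Submodule.le_topologicalClosure _ (Submodule.subset_span ⟨i, rfl⟩)) x

/-! ### Wandering subspaces and the Wold decomposition -/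

section Wandering

variable {E : Type*} [NormedAddCommGroup E] [InnerProductSpace ℂ E]

/-- The wandering subspace `M ⊖ ζM` of a shift-invariant subspace `M`. -/
def wandering (M : Submodule ℂ (L2 E)) : Submodule ℂ (L2 E) :=
  M ⊓ (M.map (shift 1).toLinearMap)ᗮ

theorem isClosed_wandering {M : Submodule ℂ (L2 E)} (hM : IsClosed (M : Set (L2 E))) :
    IsClosed (wandering M : Set (L2 E)) :=
  hM.inter (Submodule.isClosed_orthogonal _)

theorem isClosed_map_shift [CompleteSpace E] {M : Submodule ℂ (L2 E)}
    (hM : IsClosed (M : Set (L2 E))) (m : ℤ) :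
    IsClosed (M.map (shift m).toLinearMap : Set (L2 E)) := by
  rw [Submodule.map_coe]
  exact (shift (E := E) m).isometry.isClosedEmbedding.isClosedMap _ hM

theorem shift_natCast_mem {M : Submodule ℂ (L2 E)} (hS : ∀ f ∈ M, shift 1 f ∈ M) (n : ℕ)
    {f : L2 E} (hf : f ∈ M) : shift n f ∈ M := by
  induction n with
  | zero => simpa [shift_zero] using hf
  | succ n ih =>
    have := hS _ ih
    rwa [shift_shift, add_comm] at this

/-- For `n > 0`, `ζⁿ f ∈ ζM` is orthogonal to `g`; for `n < 0` the roles of `f` and `g` are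
exchanged. -/
theorem inner_shift_wandering {M : Submodule ℂ (L2 E)} (hS : ∀ f ∈ M, shift 1 f ∈ M)
    {f g : L2 E} (hf : f ∈ wandering M) (hg : g ∈ wandering M) {n : ℤ} (hn : n ≠ 0) :
    inner ℂ (shift n f) g = 0 := by
  have key : ∀ {f g : L2 E}, f ∈ wandering M → g ∈ wandering M → ∀ n : ℕ,
      inner ℂ (shift (n + 1 : ℤ) f) g = 0 := by
    intro f g hf hg n
    refine (Submodule.mem_orthogonal _ _).1 hg.2 _ ⟨shift n f, shift_natCast_mem hS n hf.1, ?_⟩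
    change shift 1 (shift n f) = _
    rw [shift_shift, add_comm]
  rcases lt_or_gt_of_ne hn with h | h
  · obtain ⟨k, hk⟩ := Int.eq_ofNat_of_zero_le (show 0 ≤ -n - 1 by omega)
    have h1 := key hg hf k
    rw [← hk, sub_add_cancel] at h1
    rw [inner_shift_left, ← inner_conj_symm, h1, map_zero]
  · obtain ⟨k, hk⟩ := Int.eq_ofNat_of_zero_le (show 0 ≤ n - 1 by omega)
    have h1 := key hf hg k
    rwa [← hk, sub_add_cancel] at h1

/-- The Wold decomposition of a shift-invariant subspace of the Hardy space: it is generated by its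
wandering subspace. -/
theorem le_of_wandering_mem [CompleteSpace E] {M : Submodule ℂ (L2 E)}
    (hM : IsClosed (M : Set (L2 E)))
    (hMH : M ≤ H2 E) (hS : ∀ f ∈ M, shift 1 f ∈ M) {N : Submodule ℂ (L2 E)}
    (hN : IsClosed (N : Set (L2 E))) (hNM : N ≤ M)
    (h : ∀ f ∈ wandering M, ∀ n : ℕ, shift n f ∈ N) : M ≤ N := by
  have : CompleteSpace N := hN.completeSpace_coe
  have : CompleteSpace (M.map (shift 1).toLinearMap) :=
    (isClosed_map_shift hM 1).completeSpace_coe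
  intro f hf
  set g := f - N.starProjection f with hg
  have hgM : g ∈ M := M.sub_mem hf (hNM (N.starProjection_apply_mem f))
  have hgN : ∀ u ∈ N, inner ℂ u g = 0 :=
    (N.mem_orthogonal _).1 (N.sub_starProjection_mem_orthogonal f)
  -- The component `d` of `u` orthogonal to `ζM` is itself wandering, hence orthogonal to `u`, which
  -- forces `d = 0` and `u ∈ ζM`.
  have hdiv : ∀ u ∈ M, (∀ w ∈ wandering M, inner ℂ w u = 0) → ∃ u' ∈ M, shift 1 u' = u := by
    intro u hu hw
    set V := M.map (shift 1).toLinearMap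
    set d := u - V.starProjection u with hd
    have hdV : d ∈ Vᗮ := V.sub_starProjection_mem_orthogonal u
    have hdM : d ∈ M := by
      refine M.sub_mem hu ?_
      obtain ⟨v, hv, hv'⟩ := V.starProjection_apply_mem u
      rw [← hv']
      exact hS v hv
    have hd0 : d = 0 := by
      rw [← inner_self_eq_zero (𝕜 := ℂ), hd, inner_sub_right, ← hd, hw d ⟨hdM, hdV⟩,
        (V.mem_orthogonal' _).1 hdV _ (V.starProjection_apply_mem u), sub_zero]
    obtain ⟨v, hv, hv'⟩ := V.starProjection_apply_mem u
    exact ⟨v, hv, hv'.trans (sub_eq_zero.1 (hd.symm.trans hd0)).symm⟩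
  -- Since `g` is orthogonal to each `ζⁿ w ∈ N` with `w` wandering, division by `ζ` never stops.
  have hpow : ∀ n : ℕ, ∃ u ∈ M, shift n u = g := by
    intro n
    induction n with
    | zero => exact ⟨g, hgM, by simpa using shift_zero g⟩
    | succ n ih =>
      obtain ⟨u, hu, hug⟩ := ih
      obtain ⟨u', hu', hu''⟩ := hdiv u hu fun w hw => by
        rw [← LinearIsometry.inner_map_map (shift (E := E) n), hug]
        exact hgN _ (h w hw n)
      refine ⟨u', hu', ?_⟩
      rw [Nat.cast_succ, ← shift_shift, hu'', hug]
  have h0 : g = 0 := by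
    refine eq_zero_of_fourierCoeff fun n => ?_
    -- This exponent exceeds `n`, so the `n`-th coefficient of `g` is one of negative index of `u ∈
    -- H²`.
    obtain ⟨u, hu, hug⟩ := hpow (n.toNat + 1)
    rw [← hug, fourierCoeff_shift]
    exact hMH hu _ (by omega)
  rw [sub_eq_zero.1 (hg.symm.trans h0)]
  exact N.starProjection_apply_mem f

end Wandering

/-! ### The Beurling–Lax–Halmos theorem -/

namespace MatFun

universe u

variable {ι κ : Type*}

section Columns

variable {e : ι → L2 (Ell2 κ)}

open Classical in
/-- The matrix function whose columns are the pointwise orthonormal functions `e i`. -/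
def ofColumns [Countable ι] (he : ∀ᵐ t ∂haar, Orthonormal ℂ fun i => e i t) : MatFun ι κ where
  -- The default value `0` is taken only on a null set.
  toFun t := if h : Orthonormal ℂ fun i => e i t then
    h.orthogonalFamily.linearIsometry.toContinuousLinearMap else 0
  weaklyMeasurable x y := by
    refine aestronglyMeasurable_of_tendsto_ae (u := (Filter.atTop : Filter (Finset ι)))
      (f := fun s t => inner ℂ y (∑ i ∈ s, x i • e i t)) (fun s => ?_) ?_
    · exact aestronglyMeasurable_const.inner (Finset.aestronglyMeasurable_fun_sum s fun i _ =>
        (Lp.aestronglyMeasurable (e i)).const_smul (x i))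
    · filter_upwards [he] with t ht
      rw [dif_pos ht]
      exact ((innerSL ℂ y).continuous.tendsto _).comp (ht.orthogonalFamily.hasSum_linearIsometry x)
  bounded := by
    refine ⟨1, he.mono fun t ht => ?_⟩
    rw [dif_pos ht]
    exact ht.orthogonalFamily.linearIsometry.norm_toContinuousLinearMap_le

variable [Countable ι] (he : ∀ᵐ t ∂haar, Orthonormal ℂ fun i => e i t)

theorem ofColumns_toFun {t : Circ} (ht : Orthonormal ℂ fun i => e i t) :
    (ofColumns he).toFun t = ht.orthogonalFamily.linearIsometry.toContinuousLinearMap :=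
  dif_pos ht

theorem ofColumns_isometry : ∀ᵐ t ∂haar,
    (ContinuousLinearMap.adjoint ((ofColumns he).toFun t)).comp ((ofColumns he).toFun t)
      = ContinuousLinearMap.id ℂ (Ell2 ι) := by
  filter_upwards [he] with t ht
  refine (ContinuousLinearMap.norm_map_iff_adjoint_comp_self _).1 fun x => ?_
  rw [ofColumns_toFun he ht]
  exact ht.orthogonalFamily.linearIsometry.norm_map x

theorem mulOp_ofColumns_single [Countable κ] [DecidableEq ι] (i : ι) :
    (ofColumns he).mulOp (const (lp.single 2 i (1 : ℂ))) = e i := by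
  refine Lp.ext ?_
  filter_upwards [coeFn_mulOp_const (ofColumns he) (lp.single 2 i (1 : ℂ)), he] with t h1 ht
  rw [h1, ofColumns_toFun he ht]
  refine (ht.orthogonalFamily.linearIsometry_apply_single (1 : ℂ)).trans ?_
  simp

end Columns

/-- Links the geometry of shifts in `L²` to pointwise inner products. -/
theorem fourierCoeff_inner {E : Type*} [NormedAddCommGroup E] [InnerProductSpace ℂ E]
    (f g : L2 E) (n : ℤ) :
    fourierCoeff (fun t => (inner ℂ (f t) (g t) : ℂ)) n = inner ℂ (shift n f) g := by
  rw [L2.inner_def, fourierCoeff]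
  refine integral_congr_ae ?_
  filter_upwards [coeFn_shift n f] with t ht
  rw [ht, inner_smul_left, fourier_neg, smul_eq_mul]

theorem isClosed_rangeH2 [Countable κ] {Θ : MatFun ι κ} (hΘ : Θ.IsInner) :
    IsClosed (Θ.rangeH2 : Set (L2 (Ell2 κ))) := by
  have hiso : Isometry Θ.mulOp := AddMonoidHomClass.isometry_of_norm _ (norm_mulOp hΘ.2)
  rw [rangeH2, Submodule.map_coe]
  exact hiso.isClosedEmbedding.isClosedMap _ (isClosed_H2 _)

/-- The Beurling–Lax–Halmos theorem: a closed shift-invariant subspace of the Hardy space is the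
range of an inner function. -/
theorem exists_isInner_rangeH2_eq {κ : Type u} [Countable κ] {M : Submodule ℂ (L2 (Ell2 κ))}
    (hM : IsClosed (M : Set (L2 (Ell2 κ)))) (hMH : M ≤ H2 (Ell2 κ))
    (hS : ∀ f ∈ M, shift 1 f ∈ M) :
    ∃ (ι : Type u) (_ : Countable ι) (Θ : MatFun ι κ), Θ.IsInner ∧ M = Θ.rangeH2 := by
  classical
  have : CompleteSpace (wandering M) := (isClosed_wandering hM).completeSpace_coe
  obtain ⟨ι, b, -⟩ := exists_hilbertBasis ℂ (wandering M)
  have hb : Orthonormal ℂ fun i => (b i : L2 (Ell2 κ)) :=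
    b.orthonormal.comp_linearIsometry (wandering M).subtypeₗᵢ
  have : Fact ((2 : ENNReal) ≠ ⊤) := ⟨by norm_num⟩
  have hcount : Countable ι := hb.countable
  let e : ι → L2 (Ell2 κ) := fun i => (b i : L2 (Ell2 κ))
  have heW : ∀ i, e i ∈ wandering M := fun i => (b i).2
  have he : ∀ᵐ t ∂haar, Orthonormal ℂ fun i => e i t := by
    -- The coefficients `⟨ζⁿ e i, e j⟩` vanish for `n ≠ 0` because the `e i` are wandering, so the
    -- pointwise inner product is constant.
    have h1 : ∀ i j, ∀ᵐ t ∂haar, (inner ℂ (e i t) (e j t) : ℂ) = if i = j then 1 else 0 := by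
      intro i j
      refine ae_eq_const_of_fourierCoeff (L2.integrable_inner _ _) _ fun n => ?_
      rw [fourierCoeff_inner]
      by_cases hn : n = 0
      · rw [if_pos hn, hn, shift_zero]
        exact orthonormal_iff_ite.1 hb i j
      · rw [if_neg hn]
        exact inner_shift_wandering hS (heW i) (heW j) hn
    filter_upwards [ae_all_iff.2 fun i => ae_all_iff.2 (h1 i)] with t ht
    exact orthonormal_iff_ite.2 ht
  let Θ := ofColumns he
  have hΘM : ∀ x, Θ.mulOp (const x) ∈ M :=
    mem_of_single_mem (K := M.comap (Θ.mulOp ∘ₗ (constL (Ell2 ι)).toLinearMap))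
      (hM.preimage (Θ.continuous_mulOp.comp (constL (Ell2 ι)).continuous))
      fun i => by
        change Θ.mulOp (const _) ∈ M
        rw [mulOp_ofColumns_single]
        exact (heW i).1
  have hΘ : Θ.IsInner := ⟨Θ.isAnalytic_iff.2 fun x => hMH (hΘM x), ofColumns_isometry he⟩
  have hle : Θ.rangeH2 ≤ M := by
    refine Submodule.map_le_iff_le_comap.2 (H2_le_of_monomial_mem
      (hM.preimage Θ.continuous_mulOp) fun k x => ?_)
    rw [Submodule.mem_comap, monomial, mulOp_shift]
    exact shift_natCast_mem hS k (hΘM x)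
  refine ⟨ι, hcount, Θ, hΘ, le_antisymm ?_ hle⟩
  refine le_of_wandering_mem hM hMH hS (isClosed_rangeH2 hΘ) hle fun f hf n => ?_
  -- The basis expansion of `f`, multiplied by `ζⁿ`, is a series of multiples of `ζⁿ e i = Θ (ζⁿ
  -- δ_i)`.
  have hsum := (b.hasSum_repr ⟨f, hf⟩).mapL
    ((shift (E := Ell2 κ) n).toContinuousLinearMap.comp (wandering M).subtypeL)
  refine (isClosed_rangeH2 hΘ).mem_of_tendsto hsum
    (Filter.Eventually.of_forall fun s => Submodule.sum_mem _ fun i _ => ?_)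
  rw [map_smul]
  refine Submodule.smul_mem _ _ ⟨monomial n (lp.single 2 i (1 : ℂ)),
    monomial_mem_H2 (by positivity) _, ?_⟩
  rw [monomial, mulOp_shift, mulOp_ofColumns_single]
  rfl

theorem isClosed_toeplitzKer [Countable κ] {Φ : MatFun ι κ} (hΦ : Φ.IsAnalytic) :
    IsClosed (Φ.toeplitzKer : Set (L2 (Ell2 ι))) := by
  have : (Φ.toeplitzKer : Set (L2 (Ell2 ι)))
      = (H2 (Ell2 ι) : Set (L2 (Ell2 ι))) ∩ {f | Φ.mulOp f = 0} := by
    ext f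
    exact hΦ.mem_toeplitzKer
  rw [this]
  exact (isClosed_H2 _).inter (isClosed_eq Φ.continuous_mulOp continuous_const)

end MatFun

end OpFun

end

theorem theorem3p1 (r : ℕ) (hr : 0 < r) (Υ : OpFun.MatFun (Fin r) ℕ) (hΥ : Υ.IsInner) :
    (∃ (κ : Type) (_ : Countable κ) (Θ : OpFun.MatFun κ ℕ),
      Θ.IsInner ∧ Υ.transpose.toeplitzKer = Θ.rangeH2) ∧
    ∀ (κ : Type) [Countable κ] (Θ : OpFun.MatFun κ ℕ),
      Θ.IsInner → Υ.transpose.toeplitzKer = Θ.rangeH2 →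
        Θ.IsCoOuter ∧ OpFun.MatFun.IsUnitaryValued Υ Θ ∧
          (Υ.IsCoOuter → OpFun.MatFun.IsBalanced Υ Θ) := by
  have hΨ := hΥ.1.transpose
  refine ⟨OpFun.MatFun.exists_isInner_rangeH2_eq (OpFun.MatFun.isClosed_toeplitzKer hΨ)
    (fun f hf => (hΨ.mem_toeplitzKer.1 hf).1) fun f hf => ?_, fun κ _ Θ hΘ h => ?_⟩
  · obtain ⟨h1, h2⟩ := hΨ.mem_toeplitzKer.1 hf
    exact hΨ.mem_toeplitzKer.2 ⟨OpFun.shift_mem_H2 zero_le_one h1, by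
      rw [OpFun.MatFun.mulOp_shift, h2, map_zero]⟩
  · have hco := hΘ.isCoOuter_of_rangeH2_eq hΨ h
    have hU := hΥ.isUnitaryValued hΘ h
    exact ⟨hco, hU, fun hc => ⟨⟨hΥ, hc⟩, ⟨hΘ, hco⟩, hU⟩⟩
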